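/- All polytopes are convex polytopes (convex hulls of finite sets of points); a $d$-polytope is a polytope of dimension $d$, and its facets are its faces of dimension $d-1$. A polytope is 2-neighborly if any two of its vertices form an edge. Two polytopes are combinatorially equivalent if their face lattices are isomorphic. A pyramid over a polytope $R$ is a polytope of the form $\mathrm{conv}(B\cup\{a\})$ with $B$ a polytope combinatorially equivalent to $R$ and $a$ a point outside the affine hull of $B$; for $k\ge 1$, a $k$-fold pyramid over $R$ is obtained by taking successive pyramids $k$ times, starting from a polytope combinatorially equivalent to $R$. Let $P_{5,8,12}\subset\mathbb{R}^5$ be the convex hull of the eight points $(0,0,0,0,0)$, $(0,0,0,0,1)$, $(0,0,0,1,0)$, $(0,0,1,0,0)$, $(0,1,0,0,1)$, $(0,1,1,1,0)$, $(1,0,0,1,0)$, $(1,0,1,0,1)$ (a 2-neighborly 5-polytope with 8 vertices and 12 facets). Proposition. Let $k\ge 1$ be an integer and let $Q$ be a $k$-fold pyramid over $P_{5,8,12}$. Let $P$ be a 2-neighborly $(k+6)$-polytope with at most $k+15$ facets that has at least one facet with at least $k+8$ vertices, and suppose that every facet of $P$ with at least $k+8$ vertices is combinatorially equivalent to $Q$.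 Then $P$ is a pyramid over $Q$. -/

import Mathlib

/-- Affine dimension of a set (intended for nonempty sets). -/
noncomputable def affDim {n : ℕ} (P : Set (EuclideanSpace ℝ (Fin n))) : ℕ :=
  Module.finrank ℝ (vectorSpan ℝ P)

/-- A (nonempty) convex polytope: the convex hull of a nonempty finite set of points. -/
def IsPolytope {n : ℕ} (P : Set (EuclideanSpace ℝ (Fin n))) : Prop :=
  ∃ S : Set (EuclideanSpace ℝ (Fin n)), S.Finite ∧ S.Nonempty ∧ P = convexHull ℝ S

/-- A `d`-polytope. -/
def IsDPolytope {n : ℕ} (d : ℕ) (P : Set (EuclideanSpace ℝ (Fin n))) : Prop :=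
  IsPolytope P ∧ affDim P = d

/-- The face lattice of `P`, ordered by inclusion: the faces are the sets of maximizers of linear
functionals (so `P` itself is a face), together with the empty set. -/
abbrev FaceLattice {n : ℕ} (P : Set (EuclideanSpace ℝ (Fin n))) : Type :=
  {F : Set (EuclideanSpace ℝ (Fin n)) // IsExposed ℝ P F}

/-- Combinatorial equivalence: the face lattices are isomorphic. -/
def CombEquiv {m n : ℕ} (P : Set (EuclideanSpace ℝ (Fin m)))
    (Q : Set (EuclideanSpace ℝ (Fin n))) : Prop :=
  Nonempty (FaceLattice P ≃o FaceLattice Q)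

/-- The vertices of `P`. -/
def vertexSet {n : ℕ} (P : Set (EuclideanSpace ℝ (Fin n))) : Set (EuclideanSpace ℝ (Fin n)) :=
  P.extremePoints ℝ

/-- The facets of `P`: the nonempty faces of codimension one. -/
def facetSet {n : ℕ} (P : Set (EuclideanSpace ℝ (Fin n))) :
    Set (Set (EuclideanSpace ℝ (Fin n))) :=
  {F | IsExposed ℝ P F ∧ F.Nonempty ∧ affDim F + 1 = affDim P}

/-- `P` is 2-neighborly: the segment between any two vertices is a face of `P`. -/
def IsTwoNeighborly {n : ℕ} (P : Set (EuclideanSpace ℝ (Fin n))) : Prop :=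
  ∀ x ∈ vertexSet P, ∀ y ∈ vertexSet P, x ≠ y → IsExposed ℝ P (segment ℝ x y)

/-- `P` is a pyramid with base the polytope `B` (an apex being a point off the affine hull
of `B`). -/
def IsPyramidWithBase {n : ℕ} (P B : Set (EuclideanSpace ℝ (Fin n))) : Prop :=
  IsPolytope B ∧ ∃ a : EuclideanSpace ℝ (Fin n),
    a ∉ affineSpan ℝ B ∧ P = convexHull ℝ (insert a B)

/-- `P` is a `k`-fold pyramid over (a polytope combinatorially equivalent to) the polytope `Q`. -/
def IsKFoldPyramidOver {m n : ℕ} (Q : Set (EuclideanSpace ℝ (Fin m))) :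
    ℕ → Set (EuclideanSpace ℝ (Fin n)) → Prop
  | 0, P => IsPolytope P ∧ CombEquiv P Q
  | k + 1, P => ∃ B, IsPyramidWithBase P B ∧ IsKFoldPyramidOver Q k B

/-- `P` is a pyramid over (a polytope combinatorially equivalent to) the polytope `Q`. -/
def IsPyramidOver {m n : ℕ} (P : Set (EuclideanSpace ℝ (Fin n)))
    (Q : Set (EuclideanSpace ℝ (Fin m))) : Prop :=
  ∃ B, IsPyramidWithBase P B ∧ CombEquiv B Q

/-- The 0/1-polytope `P_{5,8,12}`, a 5-polytope with 8 vertices and 12 facets. -/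
def P5812 : Set (EuclideanSpace ℝ (Fin 5)) :=
  convexHull ℝ
    {!₂[0, 0, 0, 0, 0],
     !₂[0, 0, 0, 0, 1],
     !₂[0, 0, 0, 1, 0],
     !₂[0, 0, 1, 0, 0],
     !₂[0, 1, 0, 0, 1],
     !₂[0, 1, 1, 1, 0],
     !₂[1, 0, 0, 1, 0],
     !₂[1, 0, 1, 0, 1]}

/-! ### Faces and facets of polytopes -/

section PolytopeFaces

variable {n : ℕ} {P X Y Z A : Set (EuclideanSpace ℝ (Fin n))}

/-! Only vertex-facet incidences matter. `PyramidIncidence` isolates what is needed about a `k`-fold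
pyramid over `P5812`: a finite check for `k = 0`, inherited by pyramids and by combinatorial
equivalence. `NeighborlyIncidence` does the same for `P`, and the heart is
`NeighborlyIncidence.exists_pyramid`.

Suppose `P` is not a pyramid over one of its facets. A large facet `F` is a pyramid with base `Q`
and apex `a`; the other facet `G` through `Q` is large too, so it is a pyramid over `Q` with apex
`b`, and some vertex `c` lies off both. Each facet `S ≠ Q` of `F` lies in a second facet `φ S` of
`P`. With `F` and `G` this accounts for at least `k + 13` facets, so the set `N` of the others has
at most two. By 2-neighborliness, any two vertices lie in a facet avoiding a given third one. Hence
`N` cannot be spent carelessly: none of its members contains `a`, and at least one but at most two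
of the `S` have `b ∉ φ S`.

Let `S₁` be such an `S`, and choose a facet `T` of `F` adjacent to it, with `k + 6` vertices and `b
∈ φ T`. The facet of `φ S₁` beyond `S₁ ∩ T` must be `φ S₁ ∩ φ T`, which supplies a vertex of `φ T`
outside `F` and different from `b`. So `φ T` has at least `k + 8` vertices and is equivalent to a
`k`-fold pyramid over `P5812`; but it has two facets with `k + 6` vertices meeting in `k + 5`, which
such a pyramid does not allow. -/

theorem isExposed_setOf_eq (l : StrongDual ℝ (EuclideanSpace ℝ (Fin n))) {c : ℝ}
    (h : ∀ y ∈ P, l y ≤ c) : IsExposed ℝ P {y ∈ P | l y = c} := by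
  rintro ⟨w, hwP, hw⟩
  refine ⟨l, Set.Subset.antisymm (fun x hx => ⟨hx.1, fun y hy => hx.2 ▸ h y hy⟩)
    fun x hx => ⟨hx.1, le_antisymm (h x hx.1) (hw ▸ hx.2 w hwP)⟩⟩

theorem IsExposed.exists_eq_setOf (h : IsExposed ℝ P X) (hX : X.Nonempty) :
    ∃ (l : StrongDual ℝ (EuclideanSpace ℝ (Fin n))) (c : ℝ),
      (∀ y ∈ P, l y ≤ c) ∧ X = {y ∈ P | l y = c} := by
  obtain ⟨l, hl⟩ := h hX
  obtain ⟨w, hw⟩ := hX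
  have hw' := hw
  rw [hl] at hw'
  refine ⟨l, l w, hw'.2, ?_⟩
  rw [hl]
  exact Set.Subset.antisymm (fun x hx => ⟨hx.1, le_antisymm (hw'.2 x hx.1) (hx.2 w hw'.1)⟩)
    fun x hx => ⟨hx.1, fun y hy => hx.2 ▸ hw'.2 y hy⟩

theorem le_of_mem_convexHull {S : Set (EuclideanSpace ℝ (Fin n))}
    (l : StrongDual ℝ (EuclideanSpace ℝ (Fin n))) {c : ℝ} (h : ∀ s ∈ S, l s ≤ c)
    {y : EuclideanSpace ℝ (Fin n)} (hy : y ∈ convexHull ℝ S) : l y ≤ c :=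
  convexHull_min (t := {y | l y ≤ c}) h
    (convex_halfSpace_le l.toLinearMap.isLinear c) hy

namespace IsPolytope

theorem isCompact (hP : IsPolytope P) : IsCompact P := by
  obtain ⟨S, hS, -, rfl⟩ := hP
  exact hS.isCompact_convexHull ℝ

theorem convex (hP : IsPolytope P) : Convex ℝ P := by
  obtain ⟨S, hS, -, rfl⟩ := hP
  exact convex_convexHull ℝ S

theorem nonempty (hP : IsPolytope P) : P.Nonempty := by
  obtain ⟨S, -, hS, rfl⟩ := hP
  exact hS.convexHull

theorem finite_vertexSet (hP : IsPolytope P) : (vertexSet P).Finite := by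
  obtain ⟨S, hS, -, rfl⟩ := hP
  exact hS.subset extremePoints_convexHull_subset

theorem vertexSet_face (hX : IsExposed ℝ P X) : vertexSet X = X ∩ vertexSet P :=
  hX.isExtreme.extremePoints_eq

theorem face_eq_convexHull (hP : IsPolytope P) (hX : IsExposed ℝ P X) :
    X = convexHull ℝ (vertexSet X) := by
  have hfin : (vertexSet X).Finite := by
    rw [vertexSet_face hX]
    exact hP.finite_vertexSet.subset Set.inter_subset_right
  have h := closure_convexHull_extremePoints (hX.isCompact hP.isCompact) (hX.convex hP.convex)
  exact h.symm.trans (hfin.isClosed_convexHull ℝ).closure_eq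

theorem eq_convexHull (hP : IsPolytope P) : P = convexHull ℝ (vertexSet P) :=
  hP.face_eq_convexHull (IsExposed.refl P)

theorem vertexSet_nonempty (hP : IsPolytope P) : (vertexSet P).Nonempty :=
  hP.isCompact.extremePoints_nonempty hP.nonempty

theorem face (hP : IsPolytope P) (hX : IsExposed ℝ P X) (hne : X.Nonempty) : IsPolytope X :=
  ⟨vertexSet X, (vertexSet_face hX) ▸ hP.finite_vertexSet.subset Set.inter_subset_right,
    (hX.isCompact hP.isCompact).extremePoints_nonempty hne, hP.face_eq_convexHull hX⟩

theorem subset_iff (hP : IsPolytope P) (hX : IsExposed ℝ P X) (hY : IsExposed ℝ P Y) :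
    X ⊆ Y ↔ vertexSet X ⊆ vertexSet Y := by
  constructor
  · intro h
    rw [vertexSet_face hX, vertexSet_face hY]
    exact Set.inter_subset_inter_left _ h
  · intro h
    rw [hP.face_eq_convexHull hX, hP.face_eq_convexHull hY]
    exact convexHull_mono h

theorem eq_of_vertexSet_eq (hP : IsPolytope P) (hX : IsExposed ℝ P X) (hY : IsExposed ℝ P Y)
    (h : vertexSet X = vertexSet Y) : X = Y := by
  rw [hP.face_eq_convexHull hX, hP.face_eq_convexHull hY, h]

/-- Perturb the functional exposing `X` by a small multiple `ε` of the one exposing `Y` in `X`. As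
there are finitely many vertices, some `ε > 0` keeps all vertices off `X` strictly below the
maximum, and among those of `X` the second functional decides. -/
theorem trans (hP : IsPolytope P) (hX : IsExposed ℝ P X) (hY : IsExposed ℝ X Y) :
    IsExposed ℝ P Y := by
  rcases Y.eq_empty_or_nonempty with rfl | hYne
  · exact isExposed_empty
  have hXne : X.Nonempty := hYne.mono hY.subset
  have hXp := hP.face hX hXne
  obtain ⟨l, c, hl, hXl⟩ := hX.exists_eq_setOf hXne
  obtain ⟨g, d, hg, hYg⟩ := hY.exists_eq_setOf hYne
  have hmemX : ∀ y, y ∈ X ↔ y ∈ P ∧ l y = c := fun y => by rw [hXl]; rfl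
  have hmemY : ∀ y, y ∈ Y ↔ y ∈ X ∧ g y = d := fun y => by
    constructor
    · intro h; rw [hYg] at h; exact h
    · intro h; rw [hYg]; exact h
  have key : ∀ᶠ ε in nhdsWithin (0 : ℝ) (Set.Ioi 0), ∀ s ∈ vertexSet P,
      l s < c → l s + ε * g s < c + ε * d := by
    refine (hP.finite_vertexSet.eventually_all).2 fun s _ => ?_
    by_cases hs : l s < c
    · have ht : Filter.Tendsto (fun ε : ℝ => l s + ε * g s - ε * d) (nhdsWithin 0 (Set.Ioi 0))
          (nhds (l s + 0 * g s - 0 * d)) :=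
        ((by fun_prop : Continuous fun ε : ℝ => l s + ε * g s - ε * d).tendsto 0).mono_left
          nhdsWithin_le_nhds
      filter_upwards [ht.eventually_lt_const (by simpa using hs)] with ε hε _
      linarith
    · exact Filter.Eventually.of_forall fun _ h => absurd h hs
  obtain ⟨ε, hε, hε0⟩ := (key.and self_mem_nhdsWithin).exists
  have hε0 : 0 < ε := hε0
  have hle : ∀ s ∈ vertexSet P, (l + ε • g) s ≤ c + ε * d := by
    intro s hs
    rcases (hl s hs.1).lt_or_eq with h | h
    · simpa using (hε s hs h).le
    · have := hg s ((hmemX s).2 ⟨hs.1, h⟩)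
      simp only [add_apply, smul_apply, smul_eq_mul, h]
      gcongr
  have hZ : IsExposed ℝ P {y ∈ P | (l + ε • g) y = c + ε * d} :=
    isExposed_setOf_eq _ fun y hy => le_of_mem_convexHull _ hle (by rwa [← hP.eq_convexHull])
  suffices Y = {y ∈ P | (l + ε • g) y = c + ε * d} by rwa [this]
  rw [hXp.face_eq_convexHull hY, hP.face_eq_convexHull hZ, vertexSet_face hY, vertexSet_face hX,
    vertexSet_face hZ]
  congr 1
  ext s
  constructor
  · rintro ⟨hsY, hsX, hs⟩
    refine ⟨⟨hs.1, ?_⟩, hs⟩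
    simp [((hmemX s).1 hsX).2, ((hmemY s).1 hsY).2]
  · rintro ⟨⟨-, hsZ⟩, hs⟩
    have hsl : l s = c := by
      by_contra hne
      exact absurd hsZ (ne_of_lt (by simpa using hε s hs (lt_of_le_of_ne (hl s hs.1) hne)))
    have hsX := (hmemX s).2 ⟨hs.1, hsl⟩
    refine ⟨(hmemY s).2 ⟨hsX, ?_⟩, hsX, hs⟩
    simp [hsl] at hsZ
    rcases hsZ with h | h
    · exact h
    · exact absurd h hε0.ne'

/-- A vertex is not in the convex hull of the other vertices, which is compact, so a functional
separates it strictly from them. -/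
theorem isExposed_singleton (hP : IsPolytope P) {x : EuclideanSpace ℝ (Fin n)}
    (hx : x ∈ vertexSet P) : IsExposed ℝ P {x} := by
  have hnot : x ∉ convexHull ℝ (vertexSet P \ {x}) := fun h =>
    (hP.convex.mem_extremePoints_iff_mem_sdiff_convexHull_sdiff.1 hx).2
      (convexHull_mono (Set.sdiff_subset_sdiff_left extremePoints_subset) h)
  have hfin : (vertexSet P \ {x}).Finite := hP.finite_vertexSet.subset Set.sdiff_subset
  obtain ⟨l, u, hlu, hux⟩ := geometric_hahn_banach_closed_point (convex_convexHull ℝ _)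
    (hfin.isClosed_convexHull ℝ) hnot
  have hlt : ∀ y ∈ vertexSet P, y ≠ x → l y < l x := fun y hy hne =>
    (hlu y (subset_convexHull ℝ _ ⟨hy, hne⟩)).trans hux
  have hle : ∀ y ∈ P, l y ≤ l x := fun y hy => by
    refine le_of_mem_convexHull (S := vertexSet P) l (fun s hs => ?_) (by rwa [← hP.eq_convexHull])
    rcases eq_or_ne s x with rfl | h
    · exact le_rfl
    · exact (hlt s hs h).le
  have hZ := isExposed_setOf_eq l hle
  suffices {y ∈ P | l y = l x} = {x} by rwa [this] at hZ
  rw [hP.face_eq_convexHull hZ, vertexSet_face hZ]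
  suffices {y ∈ P | l y = l x} ∩ vertexSet P = {x} by rw [this, convexHull_singleton]
  ext y
  constructor
  · rintro ⟨⟨-, h⟩, hy⟩
    by_contra hne
    exact (hlt y hy hne).ne h
  · rintro rfl
    exact ⟨⟨hx.1, rfl⟩, hx⟩

end IsPolytope

theorem affDim_mono (h : X ⊆ Y) : affDim X ≤ affDim Y :=
  Submodule.finrank_mono (vectorSpan_mono ℝ h)

/-- Equal dimension forces equal direction spaces, so the functional exposing `X` is constant on `Y`
as well. -/
theorem IsExposed.eq_of_affDim_le (hX : IsExposed ℝ P X) (hne : X.Nonempty) (hXY : X ⊆ Y)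
    (hY : Y ⊆ P) (h : affDim Y ≤ affDim X) : X = Y := by
  refine hXY.antisymm fun y hy => ?_
  obtain ⟨l, c, hl, hXl⟩ := hX.exists_eq_setOf hne
  obtain ⟨x, hx⟩ := hne
  have hspan : vectorSpan ℝ X = vectorSpan ℝ Y :=
    Submodule.eq_of_le_of_finrank_le (vectorSpan_mono ℝ hXY) h
  have hker : vectorSpan ℝ X ≤ LinearMap.ker l.toLinearMap := by
    rw [vectorSpan, Submodule.span_le]
    rintro _ ⟨p, hp, q, hq, rfl⟩
    rw [hXl] at hp hq
    simp [hp.2, hq.2]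
  have hyx : y - x ∈ vectorSpan ℝ X := hspan ▸ vsub_mem_vectorSpan ℝ hy (hXY hx)
  have h0 : l (y - x) = 0 := hker hyx
  rw [hXl] at hx ⊢
  refine ⟨hY hy, ?_⟩
  rw [map_sub] at h0
  linarith [hx.2]

theorem IsExposed.affDim_lt (hX : IsExposed ℝ P X) (hne : X.Nonempty) (hXP : X ≠ P) :
    affDim X < affDim P := by
  by_contra! h
  exact hXP (hX.eq_of_affDim_le hne hX.subset subset_rfl h)

/-- Rotate a supporting hyperplane of `A` until it meets a further vertex. The codimension leaves
room for a rotation that fixes `A` and does not change the slack at `x`, so `x` is never reached. -/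
theorem IsPolytope.exists_larger_face (hP : IsPolytope P) (hA : IsExposed ℝ P A)
    (hne : A.Nonempty) {x : EuclideanSpace ℝ (Fin n)} (hxP : x ∈ P) (hxA : x ∉ A)
    (hdim : affDim A + 1 < affDim P) :
    ∃ B, IsExposed ℝ P B ∧ A ⊆ B ∧ x ∉ B ∧ A ≠ B := by
  obtain ⟨l, c, hl, hAl⟩ := hA.exists_eq_setOf hne
  have hmemA : ∀ y, y ∈ A ↔ y ∈ P ∧ l y = c := fun y => by rw [hAl]; rfl
  have hlx : l x < c := lt_of_le_of_ne (hl x hxP) fun h => hxA ((hmemA x).2 ⟨hxP, h⟩)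
  have hnot : ¬ vectorSpan ℝ P ≤ vectorSpan ℝ (insert x A) := fun h => by
    have h1 := Submodule.finrank_mono h
    have h2 := finrank_vectorSpan_insert_le_set ℝ A x
    unfold affDim at hdim
    omega
  obtain ⟨w, hwP, hw⟩ := SetLike.not_le_iff_exists.1 hnot
  obtain ⟨f, hfw, hf⟩ := Submodule.exists_dual_map_eq_bot_of_notMem hw inferInstance
  have hf0 : ∀ v ∈ vectorSpan ℝ (insert x A), f v = 0 := fun v hv => by
    have : f v ∈ (vectorSpan ℝ (insert x A)).map f := Submodule.mem_map_of_mem hv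
    rwa [hf, Submodule.mem_bot] at this
  -- A functional, constant on `insert x A`, that takes a larger value somewhere on `P`.
  obtain ⟨g, d, hgA, hgx, y, hyP, hgy⟩ : ∃ (g : StrongDual ℝ (EuclideanSpace ℝ (Fin n))) (d : ℝ),
      (∀ y ∈ A, g y = d) ∧ g x = d ∧ ∃ y ∈ P, d < g y := by
    set f' : StrongDual ℝ (EuclideanSpace ℝ (Fin n)) := LinearMap.toContinuousLinearMap f with hf'
    have hc : ∀ y ∈ A, f' y = f' x := fun y hy => by
      have := hf0 (y - x) (vsub_mem_vectorSpan ℝ (Set.mem_insert_of_mem _ hy)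
        (Set.mem_insert _ _))
      rw [map_sub] at this
      exact sub_eq_zero.1 this
    by_contra! hcon
    apply hfw
    have hconst : ∀ y ∈ P, f y = f x := fun y hy => by
      have h1 := hcon f' (f' x) hc rfl y hy
      have h2 := hcon (-f') (-f' x) (fun y hy => by simp [hc y hy]) (by simp) y hy
      simp only [neg_apply, neg_le_neg_iff] at h2
      exact le_antisymm h1 h2
    have hker : vectorSpan ℝ P ≤ LinearMap.ker f := by
      rw [vectorSpan, Submodule.span_le]
      rintro _ ⟨p, hp, q, hq, rfl⟩
      simp [hconst p hp, hconst q hq]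
    exact hker hwP
  obtain ⟨v, hvP, hgv⟩ : ∃ v ∈ vertexSet P, d < g v := by
    by_contra! hcon
    exact absurd (le_of_mem_convexHull g hcon (by rwa [← hP.eq_convexHull])) (not_le.2 hgy)
  -- The vertex that stops the rotation: the least ratio is the largest `t` for which `l + t • g` is
  -- still bounded on `P` by its value on `A`.
  obtain ⟨s, ⟨hsP, hgs⟩, hmin⟩ := Set.exists_min_image {s ∈ vertexSet P | d < g s}
    (fun s => (c - l s) / (g s - d)) (hP.finite_vertexSet.subset fun _ h => h.1) ⟨v, hvP, hgv⟩
  set t := (c - l s) / (g s - d) with ht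
  have hgs' : 0 < g s - d := sub_pos.2 hgs
  have hls : l s < c := lt_of_le_of_ne (hl s hsP.1) fun h =>
    hgs.ne' (hgA s ((hmemA s).2 ⟨hsP.1, h⟩))
  have ht0 : 0 < t := div_pos (sub_pos.2 hls) hgs'
  have hle : ∀ y ∈ P, (l + t • g) y ≤ c + t * d := fun y hy => by
    refine le_of_mem_convexHull (S := vertexSet P) _ (fun z hz => ?_) (by rwa [← hP.eq_convexHull])
    simp only [add_apply, smul_apply, smul_eq_mul]
    rcases le_or_gt (g z) d with h | h
    · have := mul_le_mul_of_nonneg_left h ht0.le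
      linarith [hl z hz.1]
    · have := hmin z ⟨hz, h⟩
      rw [le_div_iff₀ (sub_pos.2 h)] at this
      linarith
  refine ⟨_, isExposed_setOf_eq _ hle, fun y hy => ⟨((hmemA y).1 hy).1, ?_⟩, fun h => ?_, fun h => ?_⟩
  · simp [((hmemA y).1 hy).2, hgA y hy]
  · have := h.2
    simp [hgx] at this
    exact hlx.ne this
  · have hs : s ∈ A := by
      rw [h]
      refine ⟨hsP.1, ?_⟩
      have : t * (g s - d) = c - l s := div_mul_cancel₀ _ hgs'.ne'
      simp only [add_apply, smul_apply, smul_eq_mul]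
      linarith
    exact hls.ne ((hmemA s).1 hs).2

theorem IsPolytope.exists_facet_of_nonempty (hP : IsPolytope P) (hA : IsExposed ℝ P A)
    (hne : A.Nonempty) {x : EuclideanSpace ℝ (Fin n)} (hxP : x ∈ P) (hxA : x ∉ A) :
    ∃ H ∈ facetSet P, A ⊆ H ∧ x ∉ H := by
  induction hk : affDim P - affDim A using Nat.strong_induction_on generalizing A with
  | _ k ih =>
    have hlt := hA.affDim_lt hne (fun h => hxA (h ▸ hxP))
    by_cases hd : affDim A + 1 = affDim P
    · exact ⟨A, ⟨hA, hne, hd⟩, subset_rfl, hxA⟩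
    · obtain ⟨B, hB, hAB, hxB, hneB⟩ := hP.exists_larger_face hA hne hxP hxA (by omega)
      have hBlt := hB.affDim_lt (hne.mono hAB) (fun h => hxB (h ▸ hxP))
      have hABd : affDim A < affDim B :=
        (hA.mono hB.subset hAB).affDim_lt hne hneB
      obtain ⟨H, hH, hBH, hxH⟩ := ih _ (by omega) hB (hne.mono hAB) hxB rfl
      exact ⟨H, hH, hAB.trans hBH, hxH⟩

theorem affDim_singleton (x : EuclideanSpace ℝ (Fin n)) :
    affDim ({x} : Set (EuclideanSpace ℝ (Fin n))) = 0 := by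
  simp [affDim]

theorem IsPolytope.exists_facet (hP : IsPolytope P) (hd : 1 ≤ affDim P) (hA : IsExposed ℝ P A)
    {x : EuclideanSpace ℝ (Fin n)} (hxP : x ∈ P) (hxA : x ∉ A) :
    ∃ H ∈ facetSet P, A ⊆ H ∧ x ∉ H := by
  rcases A.eq_empty_or_nonempty with rfl | hne
  -- The empty face has no supporting functional to rotate; a vertex other than `x` replaces it.
  · obtain ⟨y, hy, hyx⟩ : ∃ y ∈ vertexSet P, y ≠ x := by
      by_contra! h
      have : affDim P ≤ affDim ({x} : Set (EuclideanSpace ℝ (Fin n))) := by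
        apply affDim_mono
        rw [hP.eq_convexHull, ← convexHull_singleton (𝕜 := ℝ) x]
        exact convexHull_mono h
      rw [affDim_singleton] at this
      omega
    obtain ⟨H, hH, -, hxH⟩ := hP.exists_facet_of_nonempty (hP.isExposed_singleton hy)
      (Set.singleton_nonempty y) hxP (fun h => hyx h.symm)
    exact ⟨H, hH, Set.empty_subset _, hxH⟩
  · exact hP.exists_facet_of_nonempty hA hne hxP hxA

theorem facet_ne (hX : X ∈ facetSet P) : X ≠ P := by
  rintro rfl
  exact absurd hX.2.2 (by omega)

theorem facet_eq_of_subset (hX : X ∈ facetSet P) (hY : IsExposed ℝ P Y) (hYP : Y ≠ P)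
    (h : X ⊆ Y) : X = Y := by
  have h1 := hY.affDim_lt (hX.2.1.mono h) hYP
  exact hX.1.eq_of_affDim_le hX.2.1 h hY.subset (by have := hX.2.2; omega)

end PolytopeFaces

/-! ### Vertex-facet incidences of `k`-fold pyramids -/

section Combinatorics

open Finset

variable {α β : Type*} [DecidableEq α] [DecidableEq β]

/-- The properties of the vertex-facet incidences of a `k`-fold pyramid over `P5812` that are
needed below; `V` is the set of vertices and `𝓕` says which vertex sets are those of facets. -/
structure PyramidIncidence (k : ℕ) (V : Finset α) (𝓕 : Finset α → Prop) : Prop where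
  card_eq : V.card = k + 8
  ssubset : ∀ S, 𝓕 S → S ⊂ V
  antichain : ∀ S T, 𝓕 S → 𝓕 T → S ⊆ T → S = T
  -- For `k = 0` there is no such facet: those of `P5812` have at most 6 of the 8 vertices.
  exists_base : 1 ≤ k → ∃ S, 𝓕 S ∧ S.card = k + 7
  many : ∃ 𝓢 : Finset (Finset α), 𝓢.card = k + 12 ∧ ∀ S ∈ 𝓢, 𝓕 S
  -- To be applied with `S₁`, `S₂` the only facets of `F` whose neighbouring facet misses the apex
  -- `b`; avoiding both gives `T` a neighbour containing `b`.
  exists_adjacent : ∀ S₁ S₂, 𝓕 S₁ → 𝓕 S₂ → ∃ T, 𝓕 T ∧ T ≠ S₁ ∧ T ≠ S₂ ∧ T.card = k + 6 ∧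
    ∀ S, 𝓕 S → S₁ ∩ T ⊆ S → S = S₁ ∨ S = T
  card_inter : ∀ S T, 𝓕 S → 𝓕 T → S ≠ T → S.card = k + 6 → T.card = k + 6 →
    (S ∩ T).card ≤ k + 4

namespace PyramidIncidence

variable {k : ℕ} {V : Finset α} {𝓕 : Finset α → Prop}

/-- The facets of the pyramid are the base and the cones over facets of the base. Coning adds one to
every cardinality, and the base, having `k + 8` vertices, is too large for the clauses about facets
with `(k + 1) + 6`. -/
theorem pyramid (h : PyramidIncidence k V 𝓕) {a : α} (ha : a ∉ V) {𝓕' : Finset α → Prop}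
    (h' : ∀ T, 𝓕' T ↔ T = V ∨ ∃ R, 𝓕 R ∧ T = insert a R) :
    PyramidIncidence (k + 1) (insert a V) 𝓕' := by
  have haR : ∀ R, 𝓕 R → a ∉ R := fun R hR haR => ha ((h.ssubset R hR).1 haR)
  have hins : ∀ R, 𝓕 R → 𝓕' (insert a R) := fun R hR => (h' _).2 (Or.inr ⟨R, hR, rfl⟩)
  have hsub : ∀ R T : Finset α, a ∉ R → (insert a R ⊆ insert a T) → R ⊆ T := fun R T haR hRT =>
    (insert_subset_insert_iff haR).1 hRT
  obtain ⟨𝓢, h𝓢c, h𝓢⟩ := h.many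
  obtain ⟨R₀, hR₀⟩ : ∃ R, 𝓕 R := by
    obtain ⟨R, hR⟩ := card_pos.1 (by omega : 0 < 𝓢.card)
    exact ⟨R, h𝓢 R hR⟩
  have hinj : ∀ R T, 𝓕 R → 𝓕 T → insert a R = insert a T → R = T := fun R T hR hT hRT =>
    h.antichain R T hR hT (hsub R T (haR R hR) hRT.subset)
  constructor
  · rw [card_insert_of_notMem ha, h.card_eq]
  · intro S hS
    rcases (h' S).1 hS with rfl | ⟨R, hR, rfl⟩
    · exact ssubset_insert ha
    · exact ⟨insert_subset_insert a (h.ssubset R hR).1, fun hVR =>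
        (h.ssubset R hR).2 (hsub _ _ ha hVR)⟩
  · intro S T hS hT hST
    rcases (h' S).1 hS with rfl | ⟨R, hR, rfl⟩ <;> rcases (h' T).1 hT with rfl | ⟨R', hR', rfl⟩
    · rfl
    · exact absurd ((subset_insert_iff_of_notMem ha).1 hST) (h.ssubset R' hR').2
    · exact absurd (hST (mem_insert_self _ _)) ha
    · rw [h.antichain R R' hR hR' (hsub _ _ (haR R hR) hST)]
  · exact fun _ => ⟨V, (h' V).2 (Or.inl rfl), by rw [h.card_eq]⟩
  · refine ⟨insert V (𝓢.image (insert a)), ?_, ?_⟩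
    · rw [card_insert_of_notMem, card_image_of_injOn, h𝓢c]
      · exact fun R hR T hT => hinj R T (h𝓢 R hR) (h𝓢 T hT)
      · intro hV
        obtain ⟨R, -, hR⟩ := mem_image.1 hV
        exact ha (hR ▸ mem_insert_self a R)
    · intro S hS
      rcases mem_insert.1 hS with rfl | hS
      · exact (h' _).2 (Or.inl rfl)
      · obtain ⟨R, hR, rfl⟩ := mem_image.1 hS
        exact hins R (h𝓢 R hR)
  · -- `S₂` only has to be avoided, so it may be replaced by a facet of the base.
    have hS₂ : ∀ S₂, 𝓕' S₂ → ∃ R₂, 𝓕 R₂ ∧ ∀ T, 𝓕 T → T ≠ R₂ → insert a T ≠ S₂ := by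
      intro S₂ hS₂
      rcases (h' S₂).1 hS₂ with rfl | ⟨R₂, hR₂, rfl⟩
      · exact ⟨R₀, hR₀, fun T _ _ hT => ha (hT ▸ mem_insert_self a T)⟩
      · exact ⟨R₂, hR₂, fun T hT hne hT' => hne (hinj _ _ hT hR₂ hT')⟩
    intro S₁ S₂ h₁ h₂
    obtain ⟨R₂, hR₂, hne₂⟩ := hS₂ S₂ h₂
    rcases (h' S₁).1 h₁ with rfl | ⟨R₁, hR₁, rfl⟩
    -- The base meets a cone in the base of that cone, so by the antichain property it is adjacent
    -- to every cone.
    · obtain ⟨T, hT, hT2, -, hTc, -⟩ := h.exists_adjacent R₂ R₂ hR₂ hR₂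
      refine ⟨insert a T, hins T hT, fun hT' => ha (hT' ▸ mem_insert_self a T), hne₂ T hT hT2,
        by rw [card_insert_of_notMem (haR T hT), hTc], fun S hS hTS => ?_⟩
      rcases (h' S).1 hS with rfl | ⟨R, hR, rfl⟩
      · exact Or.inl rfl
      · right
        congr 1
        refine (h.antichain T R hT hR fun x hx => ?_).symm
        have hxa : x ≠ a := fun hxa => haR T hT (hxa ▸ hx)
        exact (mem_insert.1 (hTS (mem_inter.2 ⟨(h.ssubset T hT).1 hx,
          mem_insert_of_mem hx⟩))).resolve_left hxa
    · obtain ⟨T, hT, hT1, hT2, hTc, hadj⟩ := h.exists_adjacent R₁ R₂ hR₁ hR₂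
      refine ⟨insert a T, hins T hT, fun hT' => hT1 (hinj _ _ hT hR₁ hT'), hne₂ T hT hT2,
        by rw [card_insert_of_notMem (haR T hT), hTc], fun S hS hTS => ?_⟩
      rw [← insert_inter_distrib] at hTS
      rcases (h' S).1 hS with rfl | ⟨R, hR, rfl⟩
      · exact absurd (hTS (mem_insert_self _ _)) ha
      · rcases hadj R hR (hsub _ _ (fun h => haR T hT (mem_inter.1 h).2) hTS) with rfl | rfl
        · exact Or.inl rfl
        · exact Or.inr rfl
  · intro S T hS hT hne hSc hTc
    rcases (h' S).1 hS with rfl | ⟨R, hR, rfl⟩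
    · have := h.card_eq
      omega
    rcases (h' T).1 hT with rfl | ⟨R', hR', rfl⟩
    · have := h.card_eq
      omega
    rw [card_insert_of_notMem (haR R hR)] at hSc
    rw [card_insert_of_notMem (haR R' hR')] at hTc
    rw [← insert_inter_distrib, card_insert_of_notMem (fun h => haR R hR (mem_inter.1 h).1)]
    have := h.card_inter R R' hR hR' (fun h => hne (h ▸ rfl)) (by omega) (by omega)
    omega

theorem map (h : PyramidIncidence k V 𝓕) {f : α → β} (hf : Set.InjOn f V)
    {𝓕' : Finset β → Prop} (h' : ∀ T, 𝓕' T ↔ ∃ R, 𝓕 R ∧ T = R.image f) :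
    PyramidIncidence k (V.image f) 𝓕' := by
  have hsub : ∀ R T : Finset α, R ⊆ V → T ⊆ V → R.image f ⊆ T.image f → R ⊆ T := by
    intro R T hR hT hRT x hx
    obtain ⟨y, hy, hyx⟩ := mem_image.1 (hRT (mem_image_of_mem f hx))
    exact hf (hT hy) (hR hx) hyx ▸ hy
  have hinj : ∀ R T, R ⊆ V → T ⊆ V → R.image f = T.image f → R = T := fun R T hR hT hRT =>
    (hsub R T hR hT hRT.subset).antisymm (hsub T R hT hR hRT.symm.subset)
  have hcard : ∀ R, R ⊆ V → (R.image f).card = R.card := fun R hR =>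
    card_image_of_injOn (hf.mono (coe_subset.2 hR))
  have hinter : ∀ R T, R ⊆ V → T ⊆ V → R.image f ∩ T.image f = (R ∩ T).image f := by
    intro R T hR hT
    exact (image_inter_of_injOn R T (hf.mono (by simp [hR, hT]))).symm
  have hV : ∀ R, 𝓕 R → R ⊆ V := fun R hR => (h.ssubset R hR).1
  obtain ⟨𝓢, h𝓢c, h𝓢⟩ := h.many
  constructor
  · rw [hcard V subset_rfl, h.card_eq]
  · intro S hS
    obtain ⟨R, hR, rfl⟩ := (h' S).1 hS
    exact ⟨image_subset_image (hV R hR), fun hVR =>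
      (h.ssubset R hR).2 (hsub _ _ subset_rfl (hV R hR) hVR)⟩
  · intro S T hS hT hST
    obtain ⟨R, hR, rfl⟩ := (h' S).1 hS
    obtain ⟨R', hR', rfl⟩ := (h' T).1 hT
    rw [h.antichain R R' hR hR' (hsub _ _ (hV R hR) (hV R' hR') hST)]
  · intro hk
    obtain ⟨S, hS, hSc⟩ := h.exists_base hk
    exact ⟨S.image f, (h' _).2 ⟨S, hS, rfl⟩, by rw [hcard S (hV S hS), hSc]⟩
  · refine ⟨𝓢.image (Finset.image f), ?_, ?_⟩
    · rw [card_image_of_injOn, h𝓢c]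
      exact fun R hR T hT => hinj R T (hV R (h𝓢 R hR)) (hV T (h𝓢 T hT))
    · intro S hS
      obtain ⟨R, hR, rfl⟩ := mem_image.1 hS
      exact (h' _).2 ⟨R, h𝓢 R hR, rfl⟩
  · intro S₁ S₂ h₁ h₂
    obtain ⟨R₁, hR₁, rfl⟩ := (h' S₁).1 h₁
    obtain ⟨R₂, hR₂, rfl⟩ := (h' S₂).1 h₂
    obtain ⟨T, hT, hT1, hT2, hTc, hadj⟩ := h.exists_adjacent R₁ R₂ hR₁ hR₂
    refine ⟨T.image f, (h' _).2 ⟨T, hT, rfl⟩, fun h => hT1 (hinj _ _ (hV T hT) (hV _ hR₁) h),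
      fun h => hT2 (hinj _ _ (hV T hT) (hV _ hR₂) h), by rw [hcard T (hV T hT), hTc], ?_⟩
    intro S hS hTS
    obtain ⟨R, hR, rfl⟩ := (h' S).1 hS
    rw [hinter _ _ (hV _ hR₁) (hV T hT)] at hTS
    rcases hadj R hR (hsub _ _ (inter_subset_left.trans (hV _ hR₁)) (hV R hR) hTS) with rfl | rfl
    · exact Or.inl rfl
    · exact Or.inr rfl
  · intro S T hS hT hne hSc hTc
    obtain ⟨R, hR, rfl⟩ := (h' S).1 hS
    obtain ⟨R', hR', rfl⟩ := (h' T).1 hT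
    rw [hcard R (hV R hR)] at hSc
    rw [hcard R' (hV R' hR')] at hTc
    rw [hinter _ _ (hV R hR) (hV R' hR'), hcard _ (inter_subset_left.trans (hV R hR))]
    exact h.card_inter R R' hR hR' (fun h => hne (h ▸ rfl)) hSc hTc

end PyramidIncidence

/-! ### The combinatorial argument for 2-neighborly polytopes -/

/-- The incidence properties of the facets of a 2-neighborly polytope with vertex set `V`:
`𝓗` is the set of vertex sets of facets, `sub E H` says that `E` is the vertex set of a facet of
the facet with vertex set `H`, and `face D` that `D` is the vertex set of a face. -/
structure NeighborlyIncidence (V : Finset α) (𝓗 : Finset (Finset α))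
    (sub : Finset α → Finset α → Prop) (face : Finset α → Prop) : Prop where
  subset : ∀ H ∈ 𝓗, H ⊆ V
  face_facet : ∀ H ∈ 𝓗, face H
  face_inter : ∀ A B, face A → face B → face (A ∩ B)
  exists_other : ∀ E, ∀ H ∈ 𝓗, sub E H → ∃ H' ∈ 𝓗, H' ≠ H ∧ E = H ∩ H'
  exists_other_sub : ∀ E D, ∀ H ∈ 𝓗, sub E H → face D → D ⊆ E → D ≠ E →
    ∃ E', sub E' H ∧ E' ≠ E ∧ D ⊆ E'
  sub_of_subset : ∀ E, ∀ F ∈ 𝓗, ∀ H ∈ 𝓗, sub E F → E ⊆ H → H ≠ F → sub E H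
  sub_antichain : ∀ E E', ∀ H ∈ 𝓗, sub E H → sub E' H → E ⊆ E' → E = E'
  antichain : ∀ H ∈ 𝓗, ∀ H' ∈ 𝓗, H ⊆ H' → H = H'
  exists_separating : ∀ x ∈ V, ∀ y ∈ V, ∀ z ∈ V, x ≠ y → z ≠ x → z ≠ y →
    ∃ H ∈ 𝓗, x ∈ H ∧ y ∈ H ∧ z ∉ H

namespace NeighborlyIncidence

variable {V : Finset α} {𝓗 : Finset (Finset α)} {sub : Finset α → Finset α → Prop}
  {face : Finset α → Prop}

/-- If all facets through `c` that avoid `a` coincide, they consist of all vertices but `a`. -/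
theorem exists_pyramid_of_subsingleton (h : NeighborlyIncidence V 𝓗 sub face) {a b c : α}
    (ha : a ∈ V) (hb : b ∈ V) (hc : c ∈ V) (hab : a ≠ b) (hac : a ≠ c) (hbc : b ≠ c)
    (huniq : ∀ Y ∈ 𝓗, ∀ Z ∈ 𝓗, c ∈ Y → a ∉ Y → c ∈ Z → a ∉ Z → Y = Z) :
    ∃ H ∈ 𝓗, ∃ a ∈ V, a ∉ H ∧ V.erase a ⊆ H := by
  obtain ⟨Y, hY, hcY, -, haY⟩ := h.exists_separating c hc b hb a ha hbc.symm hac hab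
  refine ⟨Y, hY, a, ha, haY, fun x hx => ?_⟩
  obtain ⟨hxa, hxV⟩ := mem_erase.1 hx
  rcases eq_or_ne c x with rfl | hcx
  · exact hcY
  -- Each further vertex `x` shares with `c` a facet avoiding `a`, and that facet can only be `Y`.
  · obtain ⟨Z, hZ, hcZ, hxZ, haZ⟩ := h.exists_separating c hc x hxV a ha hcx hac hxa.symm
    exact huniq Z hZ Y hY hcZ haZ hcY haY ▸ hxZ

/-- A count of facets leaves at most two beyond those forced by `F` and `G`; every way of using
these two leads to a pyramid or to a large facet with an impossible pair of facets. -/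
theorem exists_pyramid {k : ℕ} (hk : 1 ≤ k) (h : NeighborlyIncidence V 𝓗 sub face)
    (hcard : 𝓗.card ≤ k + 15) (hlarge : ∃ F ∈ 𝓗, k + 8 ≤ F.card)
    (hinc : ∀ F ∈ 𝓗, k + 8 ≤ F.card → PyramidIncidence k F (fun E => sub E F)) :
    ∃ H ∈ 𝓗, ∃ a ∈ V, a ∉ H ∧ V.erase a ⊆ H := by
  classical
  by_contra hpyr
  obtain ⟨F, hF, hFc⟩ := hlarge
  have hFi := hinc F hF hFc
  replace hFc := hFi.card_eq
  obtain ⟨Q, hQ, hQc⟩ := hFi.exists_base hk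
  have hQF : Q ⊆ F := (hFi.ssubset Q hQ).1
  -- The apex `a` of `F`, and the second facet `G` through the base `Q` of `F`.
  obtain ⟨a, haF⟩ : ∃ a, F \ Q = {a} := by
    rw [← card_eq_one, card_sdiff_of_subset hQF]
    omega
  have hmemF : ∀ x, x ∈ F ↔ x ∈ Q ∨ x = a := fun x => by
    have := congrArg (x ∈ ·) haF
    simp only [mem_sdiff, mem_singleton, eq_iff_iff] at this
    have := @hQF x
    tauto
  have haQ : a ∉ Q := fun h => by
    have : a ∈ F \ Q := haF ▸ mem_singleton_self a
    exact (mem_sdiff.1 this).2 h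
  obtain ⟨G, hG, hGF, hQG⟩ := h.exists_other Q F hF hQ
  have hQG' : Q ⊆ G := hQG ▸ inter_subset_right
  have hQsubG : sub Q G := h.sub_of_subset Q F hF G hG hQ hQG' hGF
  have haG : a ∉ G := fun haG => haQ (hQG ▸ mem_inter.2 ⟨(hmemF a).2 (Or.inr rfl), haG⟩)
  have hGQ : G ≠ Q := fun hGQ => hGF (h.antichain G hG F hF (hGQ ▸ hQF))
  -- `G` properly contains `Q`, so it has at least `k + 8` vertices and is again of the known type.
  have hGi := hinc G hG (by
    have := card_lt_card (lt_of_le_of_ne hQG' hGQ.symm)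
    omega)
  obtain ⟨b, hbG⟩ : ∃ b, G \ Q = {b} := by
    rw [← card_eq_one, card_sdiff_of_subset hQG', hGi.card_eq]
    omega
  have hmemG : ∀ x, x ∈ G ↔ x ∈ Q ∨ x = b := fun x => by
    have := congrArg (x ∈ ·) hbG
    simp only [mem_sdiff, mem_singleton, eq_iff_iff] at this
    have := @hQG' x
    tauto
  have hbGm : b ∈ G := (hmemG b).2 (Or.inr rfl)
  have hbF : b ∉ F := fun hbF => by
    have hbQ : b ∈ Q := hQG ▸ mem_inter.2 ⟨hbF, hbGm⟩
    have : b ∈ G \ Q := hbG ▸ mem_singleton_self b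
    exact (mem_sdiff.1 this).2 hbQ
  have hbQ : b ∉ Q := fun h => hbF (hQF h)
  have haFm : a ∈ F := (hmemF a).2 (Or.inr rfl)
  have haV : a ∈ V := h.subset F hF haFm
  have hbV : b ∈ V := h.subset G hG hbGm
  have hab : a ≠ b := fun h => hbF (h ▸ haFm)
  -- A vertex `c` off both facets.
  obtain ⟨c, hcV, hcF, hcb⟩ : ∃ c ∈ V, c ∉ F ∧ c ≠ b := by
    by_contra! hcon
    refine hpyr ⟨F, hF, b, hbV, hbF, fun x hx => ?_⟩
    by_contra hxF
    exact (mem_erase.1 hx).1 (hcon x (mem_erase.1 hx).2 hxF)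
  have hcG : c ∉ G := fun hcG => ((hmemG c).1 hcG).elim (fun h => hcF (hQF h)) hcb
  have hac : a ≠ c := fun h => hcF (h ▸ haFm)
  -- The facets of `F` other than `Q`, and the corresponding facets of `G`.
  have haS : ∀ S, sub S F → S ≠ Q → a ∈ S := fun S hS hne => by
    by_contra haS
    refine hne (hFi.antichain S Q hS hQ fun x hx => ?_)
    exact ((hmemF x).1 ((hFi.ssubset S hS).1 hx)).resolve_right fun hxa => haS (hxa ▸ hx)
  have hSQ : ∀ S, sub S F → S ≠ Q → S ∩ Q = S.erase a := fun S hS hne => by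
    ext x
    have := hmemF x
    have := @(hFi.ssubset S hS).1 x
    have : x = a → x ∉ Q := fun h => h ▸ haQ
    simp only [mem_inter, mem_erase]
    tauto
  have heq : ∀ S T, sub S F → S ≠ Q → sub T F → T ≠ Q → S ∩ Q ⊆ T → S = T := by
    intro S T hS hSne hT hTne hST
    refine hFi.antichain S T hS hT fun x hx => ?_
    rcases eq_or_ne x a with rfl | hxa
    · exact haS T hT hTne
    · exact hST (hSQ S hS hSne ▸ mem_erase.2 ⟨hxa, hx⟩)
  have hfaceF : ∀ E H, H ∈ 𝓗 → sub E H → face E := fun E H hH hE => by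
    obtain ⟨H', hH', -, rfl⟩ := h.exists_other E H hH hE
    exact h.face_inter _ _ (h.face_facet _ hH) (h.face_facet _ hH')
  -- Let `S'` be a facet of `G` other than `Q` through `S ∩ Q`. Its trace on `Q` lies in a facet `T
  -- ≠ Q` of `F`; then `S ∩ Q ⊆ T` forces `T = S`, so `S'` and `S` have the same trace on `Q`.
  have hsubG : ∀ S, sub S F → S ≠ Q → sub (insert b (S ∩ Q)) G := by
    intro S hS hSne
    have hne : S ∩ Q ≠ Q := fun hSQ' =>
      hSne (hFi.antichain Q S hQ hS (inter_eq_right.1 hSQ')).symm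
    obtain ⟨S', hS', hS'ne, hSS'⟩ := h.exists_other_sub Q (S ∩ Q) G hG hQsubG
      (h.face_inter _ _ (hfaceF S F hF hS) (hfaceF Q F hF hQ)) inter_subset_right hne
    have hS'G := (hGi.ssubset S' hS').1
    have hS'Q : S' ∩ Q ≠ Q := fun h' =>
      hS'ne (hGi.antichain Q S' hQsubG hS' (inter_eq_right.1 h')).symm
    obtain ⟨T, hT, hTne, hTS'⟩ := h.exists_other_sub Q (S' ∩ Q) F hF hQ
      (h.face_inter _ _ (hfaceF S' G hG hS') (hfaceF Q F hF hQ)) inter_subset_right hS'Q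
    have hST : S = T := heq S T hS hSne hT hTne
      ((subset_inter hSS' inter_subset_right).trans hTS')
    have hbS' : b ∈ S' := by
      by_contra hbS'
      refine hS'ne (hGi.antichain S' Q hS' hQsubG fun x hx => ?_)
      exact ((hmemG x).1 (hS'G hx)).resolve_right fun hxb => hbS' (hxb ▸ hx)
    suffices insert b (S ∩ Q) = S' by rwa [this]
    refine (insert_subset hbS' hSS').antisymm fun x hx => ?_
    rcases (hmemG x).1 (hS'G hx) with hxQ | rfl
    · exact mem_insert_of_mem (mem_inter.2 ⟨hST ▸ hTS' (mem_inter.2 ⟨hx, hxQ⟩), hxQ⟩)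
    · exact mem_insert_self _ _
  -- The facet `φ S` meets `F` in `S`.
  have hφ : ∀ S, ∃ H, sub S F → H ∈ 𝓗 ∧ H ≠ F ∧ S = F ∩ H := fun S => by
    by_cases hS : sub S F
    · obtain ⟨H, hH⟩ := h.exists_other S F hF hS
      exact ⟨H, fun _ => hH⟩
    · exact ⟨∅, fun h => absurd h hS⟩
  choose φ hφ using hφ
  have hφinj : ∀ S T, sub S F → sub T F → φ S = φ T → S = T := fun S T hS hT hST => by
    rw [(hφ S hS).2.2, (hφ T hT).2.2, hST]
  have hφa : ∀ S, sub S F → S ≠ Q → a ∈ φ S := fun S hS hne => by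
    have := haS S hS hne
    rw [(hφ S hS).2.2] at this
    exact (mem_inter.1 this).2
  have hφQ : ∀ S, sub S F → φ S ∩ Q = S ∩ Q := fun S hS => by
    conv_rhs => rw [(hφ S hS).2.2, inter_comm F, inter_assoc, inter_eq_right.2 hQF]
  obtain ⟨𝓢, h𝓢c, h𝓢⟩ := hFi.many
  set N := 𝓗.filter fun H => H ≠ F ∧ H ≠ G ∧ ∀ S, sub S F → S ≠ Q → H ≠ φ S with hN
  -- Besides `F` and `G` there are at least `k + 11` distinct `φ S`, since removing `Q` from the `k
  -- + 12` listed facets costs at most one; `k + 15` is the total allowed.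
  have hNc : N.card ≤ 2 := by
    set M := insert F (insert G ((𝓢.erase Q).image φ)) with hM
    have hMc : k + 13 ≤ M.card := by
      rw [hM, card_insert_of_notMem, card_insert_of_notMem, card_image_of_injOn]
      · have := pred_card_le_card_erase (s := 𝓢) (a := Q)
        omega
      · exact fun S hS T hT => hφinj S T (h𝓢 S (mem_erase.1 hS).2) (h𝓢 T (mem_erase.1 hT).2)
      · intro hG'
        obtain ⟨S, hS, hSG⟩ := mem_image.1 hG'
        exact haG (hSG ▸ hφa S (h𝓢 S (mem_erase.1 hS).2) (mem_erase.1 hS).1)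
      · intro hF'
        rcases mem_insert.1 hF' with hF' | hF'
        · exact hGF hF'.symm
        · obtain ⟨S, hS, hSF⟩ := mem_image.1 hF'
          exact (hφ S (h𝓢 S (mem_erase.1 hS).2)).2.1 hSF
    have hdisj : Disjoint N M := by
      rw [disjoint_left]
      intro H hHN hHM
      obtain ⟨-, h1, h2, h3⟩ := mem_filter.1 hHN
      rcases mem_insert.1 hHM with hH | hH
      · exact h1 hH
      rcases mem_insert.1 hH with hH | hH
      · exact h2 hH
      obtain ⟨S, hS, rfl⟩ := mem_image.1 hH
      exact h3 S (h𝓢 S (mem_erase.1 hS).2) (mem_erase.1 hS).1 rfl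
    have hsub : N ∪ M ⊆ 𝓗 := by
      refine union_subset (filter_subset _ _) (insert_subset hF (insert_subset hG fun H hH => ?_))
      obtain ⟨S, hS, rfl⟩ := mem_image.1 hH
      exact (hφ S (h𝓢 S (mem_erase.1 hS).2)).1
    have := card_le_card hsub
    rw [card_union_of_disjoint hdisj] at this
    omega
  have hmemN : ∀ H ∈ 𝓗, c ∈ H → a ∉ H → H ∈ N := fun H hH hcH haH =>
    mem_filter.2 ⟨hH, fun h => hcF (h ▸ hcH), fun h => hcG (h ▸ hcH),
      fun S hS hne h => haH (h ▸ hφa S hS hne)⟩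
  -- No facet in `N` contains `a`.
  have hNa : ∀ H ∈ N, a ∉ H := by
    by_contra! hcon
    obtain ⟨X, hXN, haX⟩ := hcon
    -- With `X` taking one of the two places in `N`, only one is left for the facets through `c`
    -- avoiding `a`.
    refine hpyr (h.exists_pyramid_of_subsingleton haV hbV hcV hab hac hcb.symm ?_)
    intro Y hY Z hZ hcY haY hcZ haZ
    have hsub : {X, Y, Z} ⊆ N := by
      simp only [insert_subset_iff, singleton_subset_iff]
      exact ⟨hXN, hmemN Y hY hcY haY, hmemN Z hZ hcZ haZ⟩
    by_contra hYZ
    have := card_le_card hsub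
    rw [card_eq_three.2 ⟨X, Y, Z, fun h => haY (h ▸ haX), fun h => haZ (h ▸ haX), hYZ, rfl⟩] at this
    omega
  -- A facet of `F` other than `Q` is shared if its `φ` contains `b`.
  have hnonshared : ∀ S, ∃ H, sub S F → S ≠ Q → b ∉ φ S → H ∈ N ∧ b ∈ H ∧ H ∩ Q = S ∩ Q := by
    intro S
    by_cases hS : sub S F ∧ S ≠ Q ∧ b ∉ φ S
    swap
    · exact ⟨∅, fun h1 h2 h3 => absurd ⟨h1, h2, h3⟩ hS⟩
    obtain ⟨hS, hne, hbS⟩ := hS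
    -- The facet across the counterpart of `S` in `G`. If it were some `φ T`, equal traces on `Q`
    -- would give `T = S`, contrary to `b ∉ φ S`.
    obtain ⟨H, hH, hHG, hSH⟩ := h.exists_other _ G hG (hsubG S hS hne)
    have hbH : b ∈ H := (mem_inter.1 (hSH ▸ mem_insert_self b (S ∩ Q))).2
    have hHQ : H ∩ Q = S ∩ Q := by
      have h1 : G ∩ H ∩ Q = insert b (S ∩ Q) ∩ Q := by rw [hSH]
      rw [inter_right_comm, inter_eq_right.2 hQG', inter_comm] at h1
      rw [h1, insert_inter_of_notMem hbQ, inter_assoc, inter_self]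
    refine ⟨H, fun _ _ _ => ⟨mem_filter.2 ⟨hH, fun h => hbF (h ▸ hbH), hHG, ?_⟩, hbH, hHQ⟩⟩
    rintro T hT hTne rfl
    rw [hφQ T hT] at hHQ
    exact hbS (heq T S hT hTne hS hne (hHQ.subset.trans inter_subset_left) ▸ hbH)
  choose ψ hψ using hnonshared
  have hψinj : ∀ S T, sub S F → S ≠ Q → b ∉ φ S → sub T F → T ≠ Q → b ∉ φ T → ψ S = ψ T →
      S = T := fun S T hS hS' hS'' hT hT' hT'' hST => by
    have := (hψ S hS hS' hS'').2.2
    rw [hST, (hψ T hT hT' hT'').2.2] at this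
    exact heq S T hS hS' hT hT' (this.symm.subset.trans inter_subset_left)
  -- Otherwise every facet through `c` avoiding `b` is in `N`. So is `Y`, which contains `b`; hence
  -- there is only one such facet and `P` is a pyramid with apex `b`.
  obtain ⟨S₁, hS₁, hS₁Q, hbS₁⟩ : ∃ S, sub S F ∧ S ≠ Q ∧ b ∉ φ S := by
    by_contra! hall
    obtain ⟨Y, hY, hbY, hcY, haY⟩ := h.exists_separating b hbV c hcV a haV hcb.symm hab hac
    refine hpyr (h.exists_pyramid_of_subsingleton hbV haV hcV hab.symm hcb.symm hac ?_)
    intro Z hZ Z' hZ' hcZ hbZ hcZ' hbZ'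
    have hmem : ∀ Z ∈ 𝓗, c ∈ Z → b ∉ Z → Z ∈ N := fun H hH hcH hbH =>
      mem_filter.2 ⟨hH, fun h => hcF (h ▸ hcH), fun h => hcG (h ▸ hcH),
        fun S hS hne h => hbH (h ▸ hall S hS hne)⟩
    have hsub : {Y, Z, Z'} ⊆ N := by
      simp only [insert_subset_iff, singleton_subset_iff]
      exact ⟨hmemN Y hY hcY haY, hmem Z hZ hcZ hbZ, hmem Z' hZ' hcZ' hbZ'⟩
    by_contra hZZ
    have := card_le_card hsub
    rw [card_eq_three.2 ⟨Y, Z, Z', fun h => hbZ (h ▸ hbY), fun h => hbZ' (h ▸ hbY), hZZ,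
      rfl⟩] at this
    omega
  -- `ψ` is injective into `N`, so there are at most two nonshared facets; if `S₁` is the only one,
  -- `S₂` is `S₁` itself.
  obtain ⟨S₂, hS₂, hcover⟩ : ∃ S₂, sub S₂ F ∧ ∀ T, sub T F → T ≠ Q → b ∉ φ T → T = S₁ ∨ T = S₂ := by
    by_cases hex : ∃ S₂, sub S₂ F ∧ S₂ ≠ Q ∧ b ∉ φ S₂ ∧ S₂ ≠ S₁
    · obtain ⟨S₂, hS₂, hS₂Q, hbS₂, hne⟩ := hex
      refine ⟨S₂, hS₂, fun T hT hTQ hbT => ?_⟩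
      by_contra! hT12
      have hsub : {ψ T, ψ S₁, ψ S₂} ⊆ N := by
        simp only [insert_subset_iff, singleton_subset_iff]
        exact ⟨(hψ T hT hTQ hbT).1, (hψ S₁ hS₁ hS₁Q hbS₁).1, (hψ S₂ hS₂ hS₂Q hbS₂).1⟩
      have := card_le_card hsub
      rw [card_eq_three.2 ⟨_, _, _, fun h => hT12.1 (hψinj _ _ hT hTQ hbT hS₁ hS₁Q hbS₁ h),
        fun h => hT12.2 (hψinj _ _ hT hTQ hbT hS₂ hS₂Q hbS₂ h),
        fun h => hne (hψinj _ _ hS₂ hS₂Q hbS₂ hS₁ hS₁Q hbS₁ h.symm), rfl⟩] at this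
      omega
    · push Not at hex
      exact ⟨S₁, hS₁, fun T hT hTQ hbT => Or.inl (hex T hT hTQ hbT)⟩
  -- A shared facet `T` of `F` adjacent to `S₁`.
  obtain ⟨T, hT, hTS₁, hTS₂, hTc, hadj⟩ := hFi.exists_adjacent S₁ S₂ hS₁ hS₂
  have hTQ : T ≠ Q := fun h => by
    rw [h] at hTc
    omega
  have hbT : b ∈ φ T := by
    by_contra hbT
    exact (hcover T hT hTQ hbT).elim hTS₁ hTS₂
  obtain ⟨hW, hWF, hWS⟩ := hφ S₁ hS₁
  obtain ⟨hX, hXF, hXT⟩ := hφ T hT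
  have hsubW : sub S₁ (φ S₁) := h.sub_of_subset S₁ F hF _ hW hS₁ (hWS.subset.trans inter_subset_right) hWF
  have hDne : S₁ ∩ T ≠ S₁ := fun hD =>
    hTS₁ (hFi.antichain S₁ T hS₁ hT (inter_eq_left.1 hD)).symm
  obtain ⟨E, hE, hES₁, hDE⟩ := h.exists_other_sub S₁ (S₁ ∩ T) _ hW hsubW
    (h.face_inter _ _ (hfaceF S₁ F hF hS₁) (hfaceF T F hF hT)) inter_subset_left hDne
  have hDE' : S₁ ∩ T ≠ E := fun hDE' =>
    hES₁ (h.sub_antichain E S₁ _ hW hE hsubW (hDE' ▸ inter_subset_left))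
  obtain ⟨X, hX', hXW, hEX⟩ := h.exists_other E _ hW hE
  have haD : a ∈ S₁ ∩ T := mem_inter.2 ⟨haS S₁ hS₁ hS₁Q, haS T hT hTQ⟩
  have hDX : S₁ ∩ T ⊆ X := hDE.trans (hEX ▸ inter_subset_right)
  -- `X` contains `a`, hence is neither `G` nor in `N`, and `X = F` would give `E = S₁`. So `X` is
  -- some `φ S` with `S₁ ∩ T ⊆ S`, and adjacency leaves only `T`.
  have hXφ : X = φ T := by
    have haX := hDX haD
    have hXN : X ∉ N := fun hXN => hNa X hXN haX
    have hXF' : X ≠ F := fun hXF' => hES₁ (by rw [hEX, hXF', inter_comm]; exact hWS.symm)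
    by_contra hne
    refine hXN (mem_filter.2 ⟨hX', hXF', fun h => haG (h ▸ haX), ?_⟩)
    rintro S hS hSQ' rfl
    have hDS : S₁ ∩ T ⊆ S := by
      rw [(hφ S hS).2.2]
      exact subset_inter (inter_subset_left.trans (hFi.ssubset S₁ hS₁).1) hDX
    rcases hadj S hS hDS with rfl | rfl
    · exact hXW rfl
    · exact hne rfl
  obtain ⟨z, hzE, hzD⟩ : ∃ z ∈ E, z ∉ S₁ ∩ T := by
    by_contra! hcon
    exact hDE' (hDE.antisymm hcon)
  rw [hEX, hXφ] at hzE
  obtain ⟨hzW, hzX⟩ := mem_inter.1 hzE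
  have hzF : z ∉ F := fun hzF => hzD (by
    rw [hWS, hXT]
    exact mem_inter.2 ⟨mem_inter.2 ⟨hzF, hzW⟩, mem_inter.2 ⟨hzF, hzX⟩⟩)
  have hzb : z ≠ b := fun hzb => hbS₁ (hzb ▸ hzW)
  have hTF : T ⊆ F := (hFi.ssubset T hT).1
  have hTX : T ⊆ φ T := hXT.subset.trans inter_subset_right
  -- `b` and `z` raise the `k + 6` vertices of `T` to `k + 8`.
  have hXi := hinc _ hX (by
    have hsub : insert z (insert b T) ⊆ φ T := insert_subset hzX (insert_subset hbT hTX)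
    have := card_le_card hsub
    rw [card_insert_of_notMem, card_insert_of_notMem (fun h => hbF (hTF h)), hTc] at this
    · omega
    · intro hz
      exact (mem_insert.1 hz).elim hzb fun hz => hzF (hTF hz))
  -- The facets `T` and `insert b (T ∩ Q)` of `φ T` have too many vertices in common.
  have h1 : sub T (φ T) := h.sub_of_subset T F hF _ hX hT hTX hXF
  have h2 : sub (insert b (T ∩ Q)) (φ T) :=
    h.sub_of_subset _ G hG _ hX (hsubG T hT hTQ)
      (insert_subset hbT (inter_subset_left.trans hTX)) (fun h => haG (h ▸ hφa T hT hTQ))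
  have hTQc : (T ∩ Q).card = k + 5 := by
    rw [hSQ T hT hTQ, card_erase_of_mem (haS T hT hTQ), hTc]
    rfl
  have h3 := hXi.card_inter T (insert b (T ∩ Q)) h1 h2
    (fun h => hbF (hTF (h ▸ mem_insert_self b _))) hTc
    (by rw [card_insert_of_notMem (fun h => hbQ (mem_inter.1 h).2), hTQc])
  have h4 := card_le_card (subset_inter (inter_subset_left : T ∩ Q ⊆ T)
    (subset_insert b (T ∩ Q)))
  omega

end NeighborlyIncidence

end Combinatorics

/-! ### Coatoms of the face lattice and combinatorial equivalence -/

section Incidence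

open scoped Classical

variable {m n k : ℕ}

/-- `X` is a coatom of the face lattice of `P`. -/
def IsMaximalFace (P X : Set (EuclideanSpace ℝ (Fin n))) : Prop :=
  IsExposed ℝ P X ∧ X ≠ P ∧ ∀ Y, IsExposed ℝ P Y → X ⊆ Y → Y ≠ P → Y = X

/-- Facets are defined by dimension, which a lattice isomorphism does not visibly preserve; coatoms
are preserved by definition. -/
theorem IsPolytope.isMaximalFace_iff {P X : Set (EuclideanSpace ℝ (Fin n))} (hP : IsPolytope P)
    (hd : 1 ≤ affDim P) : IsMaximalFace P X ↔ X ∈ facetSet P := by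
  constructor
  · rintro ⟨hX, hXP, hmax⟩
    obtain ⟨x, hxP, hxX⟩ := Set.exists_of_ssubset (hX.subset.ssubset_of_ne hXP)
    obtain ⟨H, hH, hXH, -⟩ := hP.exists_facet hd hX hxP hxX
    exact hmax H hH.1 hXH (facet_ne hH) ▸ hH
  · exact fun hX => ⟨hX.1, facet_ne hX, fun Y hY hXY hYP => (facet_eq_of_subset hX hY hYP hXY).symm⟩

/-- The vertex-facet incidences of `P` have the properties listed in `PyramidIncidence`. -/
def HasPyramidIncidence (k : ℕ) (P : Set (EuclideanSpace ℝ (Fin n))) : Prop :=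
  ∀ V : Finset (EuclideanSpace ℝ (Fin n)), (V : Set (EuclideanSpace ℝ (Fin n))) = vertexSet P →
    PyramidIncidence k V fun T => ∃ X, IsMaximalFace P X ∧
      (T : Set (EuclideanSpace ℝ (Fin n))) = vertexSet X

section CombEquiv

variable {P : Set (EuclideanSpace ℝ (Fin m))} {P' : Set (EuclideanSpace ℝ (Fin n))}

theorem orderIso_eq_empty (φ : FaceLattice P ≃o FaceLattice P') {X : FaceLattice P}
    (h : X.1 = ∅) : (φ X).1 = ∅ := by
  have : X ≤ φ.symm ⟨∅, isExposed_empty⟩ := by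
    change X.1 ⊆ _
    simp [h]
  rw [φ.le_symm_apply] at this
  exact Set.subset_empty_iff.1 this

theorem orderIso_eq_self (φ : FaceLattice P ≃o FaceLattice P') {X : FaceLattice P}
    (h : X.1 = P) : (φ X).1 = P' := by
  have : φ.symm ⟨P', IsExposed.refl P'⟩ ≤ X := by
    change _ ⊆ X.1
    rw [h]
    exact (φ.symm ⟨P', IsExposed.refl P'⟩).2.subset
  rw [φ.symm_apply_le] at this
  exact (φ X).2.subset.antisymm this

theorem orderIso_isMaximalFace (φ : FaceLattice P ≃o FaceLattice P') {X : FaceLattice P}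
    (h : IsMaximalFace P X.1) : IsMaximalFace P' (φ X).1 := by
  refine ⟨(φ X).2, fun hX => h.2.1 ?_, fun Y hY hXY hYP => ?_⟩
  · simpa using orderIso_eq_self φ.symm hX
  · have h1 : X ≤ φ.symm ⟨Y, hY⟩ := (φ.le_symm_apply).2 hXY
    have h2 := h.2.2 _ (φ.symm ⟨Y, hY⟩).2 h1 fun hY' => hYP (by
      simpa using orderIso_eq_self φ hY')
    have h3 : φ.symm ⟨Y, hY⟩ = X := Subtype.ext h2
    rw [← h3]
    simp

theorem orderIso_singleton (hP' : IsPolytope P') (φ : FaceLattice P ≃o FaceLattice P')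
    {x : EuclideanSpace ℝ (Fin m)} (hx : IsExposed ℝ P {x}) :
    ∃ x' ∈ vertexSet P', (φ ⟨{x}, hx⟩).1 = {x'} := by
  have hne : (φ ⟨{x}, hx⟩).1.Nonempty := by
    by_contra hcon
    have := orderIso_eq_empty φ.symm (Set.not_nonempty_iff_eq_empty.1 hcon)
    simp at this
  obtain ⟨x', hx'⟩ := (hP'.face (φ ⟨{x}, hx⟩).2 hne).vertexSet_nonempty
  rw [IsPolytope.vertexSet_face (φ ⟨{x}, hx⟩).2] at hx'
  refine ⟨x', hx'.2, ?_⟩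
  have hx'e := hP'.isExposed_singleton hx'.2
  have hle : φ.symm ⟨{x'}, hx'e⟩ ≤ ⟨{x}, hx⟩ :=
    (φ.symm_apply_le).2 (Set.singleton_subset_iff.2 hx'.1)
  rcases Set.subset_singleton_iff_eq.1 (show (φ.symm ⟨{x'}, hx'e⟩).1 ⊆ {x} from hle) with h | h
  · have := orderIso_eq_empty φ h
    simp at this
  · have h' : φ.symm ⟨{x'}, hx'e⟩ = ⟨{x}, hx⟩ := Subtype.ext h
    rw [← h']
    simp

/-- Singletons of vertices are the atoms of the face lattice, so the isomorphism induces an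
injection `f` of vertices, and `f` carries the vertex set of each face to that of its image. -/
theorem HasPyramidIncidence.of_combEquiv (hP : IsPolytope P) (hP' : IsPolytope P')
    (h : HasPyramidIncidence k P) (e : CombEquiv P P') : HasPyramidIncidence k P' := by
  obtain ⟨φ⟩ := e
  have hf : ∀ x, ∃ x', ∀ hx : x ∈ vertexSet P, x' ∈ vertexSet P' ∧
      (φ ⟨{x}, hP.isExposed_singleton hx⟩).1 = {x'} := fun x => by
    by_cases hx : x ∈ vertexSet P
    · obtain ⟨x', h1, h2⟩ := orderIso_singleton hP' φ (hP.isExposed_singleton hx)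
      exact ⟨x', fun _ => ⟨h1, h2⟩⟩
    · exact ⟨0, fun h => absurd h hx⟩
  choose f hf using hf
  have hmem : ∀ x ∈ vertexSet P, ∀ X : FaceLattice P, x ∈ X.1 ↔ f x ∈ (φ X).1 := by
    intro x hx X
    have h1 := φ.le_iff_le (x := ⟨{x}, hP.isExposed_singleton hx⟩) (y := X)
    have h2 : (φ ⟨{x}, hP.isExposed_singleton hx⟩).1 ⊆ (φ X).1 ↔ ({x} : Set _) ⊆ X.1 := h1
    rw [(hf x hx).2, Set.singleton_subset_iff, Set.singleton_subset_iff] at h2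
    exact h2.symm
  have hinj : Set.InjOn f (vertexSet P) := by
    intro x hx y hy hxy
    have h1 : φ ⟨{x}, hP.isExposed_singleton hx⟩ = φ ⟨{y}, hP.isExposed_singleton hy⟩ :=
      Subtype.ext (by rw [(hf x hx).2, (hf y hy).2, hxy])
    have h2 := congrArg Subtype.val (φ.injective h1)
    simpa using h2
  have hvert : ∀ X : FaceLattice P, vertexSet (φ X).1 = f '' vertexSet X.1 := by
    intro X
    rw [IsPolytope.vertexSet_face X.2, IsPolytope.vertexSet_face (φ X).2]
    ext y
    constructor
    · rintro ⟨hyX, hy⟩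
      obtain ⟨x, hx, hxy⟩ := orderIso_singleton hP φ.symm (hP'.isExposed_singleton hy)
      have h1 : φ ⟨{x}, hP.isExposed_singleton hx⟩ = ⟨{y}, hP'.isExposed_singleton hy⟩ := by
        rw [← φ.eq_symm_apply]
        exact Subtype.ext hxy.symm
      have h2 := congrArg Subtype.val h1
      rw [(hf x hx).2] at h2
      have h3 : f x = y := by simpa using h2
      exact ⟨x, ⟨(hmem x hx X).2 (h3 ▸ hyX), hx⟩, h3⟩
    · rintro ⟨x, ⟨hxX, hx⟩, rfl⟩
      exact ⟨(hmem x hx X).1 hxX, (hf x hx).1⟩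
  intro V' hV'
  set V := hP.finite_vertexSet.toFinset with hV
  have hVc : (V : Set (EuclideanSpace ℝ (Fin m))) = vertexSet P := by simp [hV]
  have hVV' : V' = V.image f := by
    rw [← Finset.coe_inj, hV', Finset.coe_image, hVc]
    have h1 := hvert ⟨P, IsExposed.refl P⟩
    rwa [orderIso_eq_self φ rfl] at h1
  rw [hVV']
  refine (h V hVc).map (hVc ▸ hinj) fun T => ?_
  constructor
  · rintro ⟨X', hX', hT⟩
    have hX := orderIso_isMaximalFace φ.symm (X := ⟨X', hX'.1⟩) hX'
    set X := φ.symm ⟨X', hX'.1⟩ with hXdef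
    have hfin : (vertexSet X.1).Finite := by
      rw [IsPolytope.vertexSet_face X.2]
      exact hP.finite_vertexSet.subset Set.inter_subset_right
    refine ⟨hfin.toFinset, ⟨X.1, hX, by simp⟩, ?_⟩
    rw [← Finset.coe_inj, hT, Finset.coe_image, Set.Finite.coe_toFinset, ← hvert X, hXdef]
    simp
  · rintro ⟨R, ⟨X, hX, hR⟩, rfl⟩
    refine ⟨_, orderIso_isMaximalFace φ (X := ⟨X, hX.1⟩) hX, ?_⟩
    rw [hvert, Finset.coe_image, hR]

end CombEquiv

/-! ### Faces of a pyramid -/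

section Pyramid

variable {P B : Set (EuclideanSpace ℝ (Fin n))} {a : EuclideanSpace ℝ (Fin n)}

theorem exists_functional_of_notMem_affineSpan (hB : B.Nonempty) (ha : a ∉ affineSpan ℝ B) :
    ∃ (g : StrongDual ℝ (EuclideanSpace ℝ (Fin n))) (c : ℝ), (∀ y ∈ B, g y = c) ∧ g a ≠ c := by
  obtain ⟨p, hp⟩ := hB
  have hpa : a - p ∉ vectorSpan ℝ B := fun h => ha (by
    have := AffineSubspace.vadd_mem_of_mem_direction
      (s := affineSpan ℝ B) (by rwa [direction_affineSpan]) (subset_affineSpan ℝ B hp)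
    simpa using this)
  obtain ⟨f, hfa, hf⟩ := Submodule.exists_dual_map_eq_bot_of_notMem hpa inferInstance
  refine ⟨LinearMap.toContinuousLinearMap f, f p, fun y hy => ?_, fun h => hfa ?_⟩
  · have : f (y - p) ∈ (vectorSpan ℝ B).map f :=
      Submodule.mem_map_of_mem (vsub_mem_vectorSpan ℝ hy hp)
    rw [hf, Submodule.mem_bot, map_sub, sub_eq_zero] at this
    simpa using this
  · rw [map_sub, sub_eq_zero]
    simpa using h

theorem pyramid_eq_convexHull (hB : IsPolytope B) :
    convexHull ℝ (insert a B) = convexHull ℝ (insert a (vertexSet B)) := by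
  refine (convexHull_min (Set.insert_subset (subset_convexHull ℝ _ (Set.mem_insert _ _)) ?_)
    (convex_convexHull ℝ _)).antisymm (convexHull_mono (Set.insert_subset_insert
      extremePoints_subset))
  conv_lhs => rw [hB.eq_convexHull]
  exact convexHull_mono (Set.subset_insert _ _)

theorem isPolytope_pyramid (hB : IsPolytope B) : IsPolytope (convexHull ℝ (insert a B)) :=
  ⟨_, hB.finite_vertexSet.insert a, Set.insert_nonempty _ _, pyramid_eq_convexHull hB⟩

/-- Adding a multiple of a functional `g` constant on `B` does not affect which points of `B` are
exposed; the multiple `t` is chosen so that the hyperplane passes through `a`. -/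
theorem exists_cone_face (hB : IsPolytope B) (ha : a ∉ affineSpan ℝ B)
    {X : Set (EuclideanSpace ℝ (Fin n))} (hX : IsExposed ℝ B X) :
    ∃ Y, IsExposed ℝ (convexHull ℝ (insert a B)) Y ∧ a ∈ Y ∧ Y ∩ B = X := by
  obtain ⟨g, c, hg, hga⟩ := exists_functional_of_notMem_affineSpan hB.nonempty ha
  obtain ⟨l, d, hl, hXl⟩ : ∃ (l : StrongDual ℝ (EuclideanSpace ℝ (Fin n))) (d : ℝ),
      (∀ y ∈ B, l y ≤ d) ∧ X = {y ∈ B | l y = d} := by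
    rcases X.eq_empty_or_nonempty with rfl | hne
    -- A bound never attained on `B` represents the empty face, whose cone then exposes the apex
    -- alone.
    · exact ⟨0, 1, fun y _ => by simp, by simp⟩
    · exact hX.exists_eq_setOf hne
  set t := (d - l a) / (g a - c) with ht
  have hta : t * (g a - c) = d - l a := div_mul_cancel₀ _ (sub_ne_zero.2 hga)
  have hle : ∀ y ∈ convexHull ℝ (insert a B), (l + t • g) y ≤ d + t * c := fun y hy => by
    refine le_of_mem_convexHull _ (fun z hz => ?_) hy
    simp only [add_apply, smul_apply, smul_eq_mul]
    rcases hz with rfl | hz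
    · linarith
    · rw [hg z hz]
      linarith [hl z hz]
  refine ⟨_, isExposed_setOf_eq _ hle, ⟨subset_convexHull ℝ _ (Set.mem_insert _ _), ?_⟩, ?_⟩
  · simp only [add_apply, smul_apply, smul_eq_mul]
    linarith
  · rw [hXl]
    ext y
    constructor
    · rintro ⟨⟨-, hy⟩, hyB⟩
      refine ⟨hyB, ?_⟩
      simpa [hg y hyB] using hy
    · rintro ⟨hyB, hy⟩
      exact ⟨⟨subset_convexHull ℝ _ (Set.mem_insert_of_mem _ hyB), by simp [hg y hyB, hy]⟩, hyB⟩

theorem isExposed_base (hB : IsPolytope B) (ha : a ∉ affineSpan ℝ B) :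
    IsExposed ℝ (convexHull ℝ (insert a B)) B := by
  obtain ⟨g, c, hg, hga⟩ := exists_functional_of_notMem_affineSpan hB.nonempty ha
  have hs : 0 < (g a - c) * (g a - c) := mul_self_pos.2 (sub_ne_zero.2 hga)
  -- The factor `c - g a` fixes the sign, so that `a` lies strictly below the value on `B`.
  have hle : ∀ y ∈ convexHull ℝ (insert a B), ((c - g a) • g) y ≤ (c - g a) * c := fun y hy => by
    refine le_of_mem_convexHull _ (fun z hz => ?_) hy
    simp only [smul_apply, smul_eq_mul]
    rcases hz with rfl | hz
    · nlinarith
    · rw [hg z hz]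
  have hZ := isExposed_setOf_eq _ hle
  suffices {y ∈ convexHull ℝ (insert a B) | ((c - g a) • g) y = (c - g a) * c} = B by
    rwa [this] at hZ
  refine Set.Subset.antisymm ?_ fun y hy =>
    ⟨subset_convexHull ℝ _ (Set.mem_insert_of_mem _ hy), by simp [hg y hy]⟩
  rw [(isPolytope_pyramid hB).face_eq_convexHull hZ]
  refine convexHull_min (fun y hy => ?_) hB.convex
  rw [IsPolytope.vertexSet_face hZ] at hy
  rcases extremePoints_convexHull_subset hy.2 with rfl | hyB
  · have := hy.1.2
    simp only [smul_apply, smul_eq_mul] at this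
    nlinarith
  · exact hyB

theorem vertexSet_pyramid (hB : IsPolytope B) (ha : a ∉ affineSpan ℝ B) :
    vertexSet (convexHull ℝ (insert a B)) = insert a (vertexSet B) := by
  have hsub : vertexSet (convexHull ℝ (insert a B)) ⊆ insert a (vertexSet B) := by
    rw [pyramid_eq_convexHull hB]
    exact extremePoints_convexHull_subset
  refine hsub.antisymm (Set.insert_subset ?_ ?_)
  · obtain ⟨Y, hY, haY, hYB⟩ := exists_cone_face hB ha (isExposed_empty (A := B))
    obtain ⟨y, hy⟩ := ((isPolytope_pyramid hB).face hY ⟨a, haY⟩).vertexSet_nonempty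
    rw [IsPolytope.vertexSet_face hY] at hy
    rcases hsub hy.2 with rfl | hyB
    · exact hy.2
    · exact absurd (hYB.subset ⟨hy.1, hyB.1⟩) (Set.notMem_empty _)
  · rw [IsPolytope.vertexSet_face (isExposed_base hB ha)]
    exact Set.inter_subset_right

/-- A face through `a` is determined by its intersection with `B`, and a face avoiding `a` lies in
`B`. So the coatoms are `B` and the cones over coatoms of `B`. -/
theorem HasPyramidIncidence.pyramid (h : IsPyramidWithBase P B) (hB : HasPyramidIncidence k B) :
    HasPyramidIncidence (k + 1) P := by
  obtain ⟨hBp, a, ha, rfl⟩ := h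
  set P := convexHull ℝ (insert a B) with hPdef
  have hP : IsPolytope P := isPolytope_pyramid hBp
  have hBe : IsExposed ℝ P B := isExposed_base hBp ha
  have hvP : vertexSet P = insert a (vertexSet B) := vertexSet_pyramid hBp ha
  have haB : a ∉ B := fun h => ha (subset_affineSpan ℝ B h)
  have haP : a ∈ P := subset_convexHull ℝ _ (Set.mem_insert _ _)
  have hBP : B ≠ P := fun h => haB (h ▸ haP)
  have hsubB : ∀ X, IsExposed ℝ P X → a ∉ X → X ⊆ B := fun X hX haX => by
    rw [hP.subset_iff hX hBe, IsPolytope.vertexSet_face hX, hvP]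
    rintro y ⟨hyX, rfl | hy⟩
    · exact absurd hyX haX
    · exact hy
  have hall : ∀ X, IsExposed ℝ P X → a ∈ X → B ⊆ X → X = P := fun X hX haX hBX =>
    hX.subset.antisymm (convexHull_min (Set.insert_subset haX hBX) (hX.convex hP.convex))
  have hinter : ∀ X, IsExposed ℝ P X → IsExposed ℝ B (X ∩ B) := fun X hX =>
    (hX.inter hBe).mono hBe.subset Set.inter_subset_right
  have hvert : ∀ X, IsExposed ℝ P X → a ∈ X → vertexSet X = insert a (vertexSet (X ∩ B)) := by
    intro X hX haX
    rw [IsPolytope.vertexSet_face hX, hvP, IsPolytope.vertexSet_face (hinter X hX),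
      Set.inter_insert_of_mem haX, Set.inter_assoc, Set.inter_eq_right.2
        (show vertexSet B ⊆ B from extremePoints_subset)]
  have hnot : ∀ X, IsExposed ℝ B X → a ∉ vertexSet X := fun X hX haX => haB (hX.subset haX.1)
  intro V hV
  have haV : a ∈ V := by
    rw [← Finset.mem_coe, hV, hvP]
    exact Set.mem_insert _ _
  have hVB : ((V.erase a : Finset _) : Set (EuclideanSpace ℝ (Fin n))) = vertexSet B := by
    rw [Finset.coe_erase, hV, hvP, Set.insert_sdiff_self_of_notMem (hnot B (IsExposed.refl B))]
  rw [← Finset.insert_erase haV]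
  refine (hB _ hVB).pyramid (Finset.notMem_erase _ _) fun T => ?_
  constructor
  · rintro ⟨X, hX, hT⟩
    by_cases haX : a ∈ X
    · right
      have hT' : ((T.erase a : Finset _) : Set (EuclideanSpace ℝ (Fin n))) =
          vertexSet (X ∩ B) := by
        rw [Finset.coe_erase, hT, hvert X hX.1 haX,
          Set.insert_sdiff_self_of_notMem (hnot _ (hinter X hX.1))]
      refine ⟨T.erase a, ⟨X ∩ B, ⟨hinter X hX.1, fun h => ?_, fun Y hY hXY hYB => ?_⟩, hT'⟩, ?_⟩
      · exact hX.2.1 (hall X hX.1 haX (Set.inter_eq_right.1 h))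
      · obtain ⟨Z, hZ, haZ, hZB⟩ := exists_cone_face hBp ha hY
        have hXZ : X ⊆ Z := by
          rw [hP.subset_iff hX.1 hZ, hvert X hX.1 haX, hvert Z hZ haZ, hZB]
          exact Set.insert_subset_insert
            ((hBp.subset_iff (hinter X hX.1) hY).1 hXY)
        rw [← hZB, hX.2.2 Z hZ hXZ fun h => hYB (by rw [← hZB, h, Set.inter_eq_right.2 hBe.subset])]
      · rw [Finset.insert_erase]
        rw [← Finset.mem_coe, hT, hvert X hX.1 haX]
        exact Set.mem_insert _ _
    · left
      have := hX.2.2 B hBe (hsubB X hX.1 haX) hBP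
      rw [← Finset.coe_inj, hT, hVB, this]
  · rintro (rfl | ⟨R, ⟨X, hX, hR⟩, rfl⟩)
    · refine ⟨B, ⟨hBe, hBP, fun Y hY hBY hYP => ?_⟩, hVB⟩
      by_cases haY : a ∈ Y
      · exact absurd (hall Y hY haY hBY) hYP
      · exact (hsubB Y hY haY).antisymm hBY
    · obtain ⟨Y, hY, haY, hYB⟩ := exists_cone_face hBp ha hX.1
      refine ⟨Y, ⟨hY, fun h => hX.2.1 ?_, fun Z hZ hYZ hZP => ?_⟩, ?_⟩
      · rw [← hYB, h, Set.inter_eq_right.2 hBe.subset]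
      · have haZ := hYZ haY
        have hZB : Z ∩ B = X := hX.2.2 _ (hinter Z hZ)
          (hYB ▸ Set.inter_subset_inter_left _ hYZ)
          fun h => hZP (hall Z hZ haZ (Set.inter_eq_right.1 h))
        exact hP.eq_of_vertexSet_eq hZ hY (by rw [hvert Z hZ haZ, hvert Y hY haY, hZB, hYB])
      · rw [Finset.coe_insert, hR, hvert Y hY haY, hYB]

end Pyramid

end Incidence

/-! ### The facets of `P5812` -/

section P5812

open scoped Classical

variable {k : ℕ}

/-- The coordinates of the vertices of `P5812`. -/
def p5812Coord : Fin 8 → Fin 5 → ℤ :=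
  ![![0, 0, 0, 0, 0], ![0, 0, 0, 0, 1], ![0, 0, 0, 1, 0], ![0, 0, 1, 0, 0], ![0, 1, 0, 0, 1],
    ![0, 1, 1, 1, 0], ![1, 0, 0, 1, 0], ![1, 0, 1, 0, 1]]

/-- The vertices of `P5812`. -/
noncomputable def p5812Vertex (i : Fin 8) : EuclideanSpace ℝ (Fin 5) :=
  WithLp.toLp 2 fun j => (p5812Coord i j : ℝ)

/-- The vertex sets of the facets of `P5812`. -/
def p5812Facet : Fin 12 → Finset (Fin 8) :=
  ![{0, 1, 2, 3, 4, 5}, {0, 1, 2, 3, 6, 7}, {0, 3, 4, 5, 6, 7}, {1, 2, 4, 5, 6, 7},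
    {0, 1, 2, 4, 6}, {0, 1, 3, 4, 7}, {0, 1, 4, 6, 7}, {0, 2, 3, 5, 6}, {0, 2, 4, 5, 6},
    {1, 2, 3, 5, 7}, {1, 3, 4, 5, 7}, {2, 3, 5, 6, 7}]

/-- The coefficients of the functionals that are maximal on the facets of `P5812`. -/
def p5812Normal : Fin 12 → Fin 5 → ℤ :=
  ![![-1, 0, 0, 0, 0], ![0, -1, 0, 0, 0], ![1, 1, 0, -1, -1], ![0, 0, 0, 1, 1],
    ![0, 0, -1, 0, 0], ![0, 0, 0, -1, 0], ![1, 0, -1, -1, 0], ![0, 0, 0, 0, -1],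
    ![0, 1, -1, 0, -1], ![-1, -1, 1, 1, 1], ![-1, 0, 1, 0, 1], ![0, -1, 1, 1, 0]]

/-- The maxima of the functionals given by `p5812Normal`. -/
def p5812Bound : Fin 12 → ℤ := ![0, 0, 0, 1, 0, 0, 0, 0, 0, 1, 1, 1]

theorem p5812Normal_le : ∀ j i, p5812Normal j ⬝ᵥ p5812Coord i ≤ p5812Bound j := by decide

theorem p5812Normal_eq_iff : ∀ j i,
    p5812Normal j ⬝ᵥ p5812Coord i = p5812Bound j ↔ i ∈ p5812Facet j := by decide

/-- On 0/1 points the functional with coefficients `2 v - 1` is maximal exactly at `v`; this exposes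
each of the eight points as a vertex. -/
theorem p5812_sub_le : ∀ i i', (fun j => 2 * p5812Coord i j - 1) ⬝ᵥ p5812Coord i' ≤
    ∑ j, p5812Coord i j := by decide

theorem p5812_sub_eq_iff : ∀ i i', (fun j => 2 * p5812Coord i j - 1) ⬝ᵥ p5812Coord i' =
    ∑ j, p5812Coord i j ↔ i' = i := by decide

theorem p5812Facet_antichain : ∀ i j, p5812Facet i ⊆ p5812Facet j → i = j := by decide

set_option maxRecDepth 10000 in
theorem p5812Facet_adjacent : ∀ i j, ∃ t, t ≠ i ∧ t ≠ j ∧ (p5812Facet t).card = 6 ∧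
    ∀ s, p5812Facet i ∩ p5812Facet t ⊆ p5812Facet s → s = i ∨ s = t := by decide

theorem p5812Facet_card_inter : ∀ i j, i ≠ j → (p5812Facet i).card = 6 →
    (p5812Facet j).card = 6 → (p5812Facet i ∩ p5812Facet j).card ≤ 4 := by decide

theorem pyramidIncidence_p5812Facet :
    PyramidIncidence 0 Finset.univ fun S => ∃ j, S = p5812Facet j where
  card_eq := by simp
  ssubset := by
    rintro _ ⟨j, rfl⟩
    revert j
    decide
  antichain := by
    rintro _ _ ⟨i, rfl⟩ ⟨j, rfl⟩ h
    rw [p5812Facet_antichain i j h]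
  exists_base := by omega
  many := by
    refine ⟨Finset.univ.image p5812Facet, ?_, by simp [eq_comm]⟩
    rw [Finset.card_image_of_injective _ fun i j h => p5812Facet_antichain i j h.subset]
    simp
  exists_adjacent := by
    rintro _ _ ⟨i, rfl⟩ ⟨j, rfl⟩
    obtain ⟨t, hi, hj, hc, hadj⟩ := p5812Facet_adjacent i j
    refine ⟨_, ⟨t, rfl⟩, fun h => hi (p5812Facet_antichain t i h.subset),
      fun h => hj (p5812Facet_antichain t j h.subset), hc, ?_⟩
    rintro _ ⟨s, rfl⟩ hs
    rcases hadj s (by convert hs) with rfl | rfl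
    · exact Or.inl rfl
    · exact Or.inr rfl
  card_inter := by
    rintro _ _ ⟨i, rfl⟩ ⟨j, rfl⟩ hne hi hj
    have := p5812Facet_card_inter i j (fun h => hne (h ▸ rfl)) hi hj
    convert this

theorem P5812_eq : P5812 = convexHull ℝ (Set.range p5812Vertex) := by
  have : Set.range p5812Vertex = {!₂[0, 0, 0, 0, 0], !₂[0, 0, 0, 0, 1], !₂[0, 0, 0, 1, 0],
     !₂[0, 0, 1, 0, 0], !₂[0, 1, 0, 0, 1], !₂[0, 1, 1, 1, 0], !₂[1, 0, 0, 1, 0],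
     !₂[1, 0, 1, 0, 1]} := by
    have h : ∀ i, p5812Vertex i = ![!₂[0, 0, 0, 0, 0], !₂[0, 0, 0, 0, 1], !₂[0, 0, 0, 1, 0],
     !₂[0, 0, 1, 0, 0], !₂[0, 1, 0, 0, 1], !₂[0, 1, 1, 1, 0], !₂[1, 0, 0, 1, 0],
     !₂[1, 0, 1, 0, 1]] i := by
      intro i
      ext j
      fin_cases i <;> fin_cases j <;> simp [p5812Vertex, p5812Coord]
    rw [funext h]
    simp only [Matrix.range_cons, Matrix.range_empty, Set.union_empty, Set.singleton_union]
  rw [this]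
  rfl

theorem isPolytope_P5812 : IsPolytope P5812 :=
  ⟨_, Set.finite_range _, Set.range_nonempty _, P5812_eq⟩

/-- The functional on `ℝ⁵` with integral coefficients `w`. -/
noncomputable def intFunctional (w : Fin 5 → ℤ) : StrongDual ℝ (EuclideanSpace ℝ (Fin 5)) :=
  ∑ j, (w j : ℝ) • EuclideanSpace.proj j

theorem intFunctional_p5812Vertex (w : Fin 5 → ℤ) (i : Fin 8) :
    intFunctional w (p5812Vertex i) = ((w ⬝ᵥ p5812Coord i : ℤ) : ℝ) := by
  simp [intFunctional, p5812Vertex, dotProduct]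

theorem p5812Vertex_mem (i : Fin 8) : p5812Vertex i ∈ P5812 :=
  P5812_eq ▸ subset_convexHull ℝ _ (Set.mem_range_self i)

theorem exists_face_P5812 (w : Fin 5 → ℤ) (b : ℤ) (h : ∀ i, w ⬝ᵥ p5812Coord i ≤ b) :
    ∃ X, IsExposed ℝ P5812 X ∧ ∀ i, p5812Vertex i ∈ X ↔ w ⬝ᵥ p5812Coord i = b := by
  refine ⟨_, isExposed_setOf_eq (intFunctional w) (c := b) fun y hy => ?_, fun i => ?_⟩
  · rw [P5812_eq] at hy
    refine le_of_mem_convexHull _ ?_ hy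
    rintro _ ⟨i, rfl⟩
    rw [intFunctional_p5812Vertex]
    exact_mod_cast h i
  · rw [Set.mem_ofPred_eq, intFunctional_p5812Vertex, and_iff_right (p5812Vertex_mem i)]
    norm_cast

theorem vertexSet_P5812 : vertexSet P5812 = Set.range p5812Vertex := by
  have hsub : vertexSet P5812 ⊆ Set.range p5812Vertex := by
    rw [P5812_eq]
    exact extremePoints_convexHull_subset
  refine hsub.antisymm ?_
  rintro _ ⟨i, rfl⟩
  obtain ⟨X, hX, hXi⟩ := exists_face_P5812 _ _ (p5812_sub_le i)
  obtain ⟨y, hy⟩ := (isPolytope_P5812.face hX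
    ⟨_, (hXi i).2 ((p5812_sub_eq_iff i i).2 rfl)⟩).vertexSet_nonempty
  rw [IsPolytope.vertexSet_face hX] at hy
  obtain ⟨i', rfl⟩ := hsub hy.2
  rw [← (p5812_sub_eq_iff i i').1 ((hXi i').1 hy.1)]
  exact hy.2

theorem p5812Vertex_injective : Function.Injective p5812Vertex := by
  intro i i' h
  obtain ⟨X, hX, hXi⟩ := exists_face_P5812 _ _ (p5812_sub_le i)
  have h1 := (hXi i).2 ((p5812_sub_eq_iff i i).2 rfl)
  rw [h, hXi] at h1
  exact ((p5812_sub_eq_iff i i').1 h1).symm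

theorem p5812_subset_P5812_iff {X Y : Set (EuclideanSpace ℝ (Fin 5))}
    (hX : IsExposed ℝ P5812 X) (hY : IsExposed ℝ P5812 Y) :
    X ⊆ Y ↔ ∀ i, p5812Vertex i ∈ X → p5812Vertex i ∈ Y := by
  refine ⟨fun h i hi => h hi, fun h => ?_⟩
  rw [isPolytope_P5812.subset_iff hX hY, IsPolytope.vertexSet_face hX,
    IsPolytope.vertexSet_face hY, vertexSet_P5812]
  rintro _ ⟨hiX, i, rfl⟩
  exact ⟨h i hiX, i, rfl⟩

set_option maxRecDepth 100000 in
/-- If `z` indicates the zeros of a nonnegative affine function on the vertices of `P5812`, then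
these are all vertices or lie in a facet; the hypotheses come from the affine dependencies between
the vertices. -/
theorem p5812_zero_pattern : ∀ z : Fin 8 → Bool,
    (z 0 ∧ z 1 ∧ z 5 ↔ z 2 ∧ z 3 ∧ z 4) → (z 0 ∧ z 2 ∧ z 7 ↔ z 1 ∧ z 3 ∧ z 6) →
    (z 0 ∧ z 5 ∧ z 7 ↔ z 3 ∧ z 4 ∧ z 6) → (z 1 ∧ z 5 ∧ z 6 ↔ z 2 ∧ z 4 ∧ z 7) →
    (∀ i, z i) ∨ ∃ j, ∀ i, z i → i ∈ p5812Facet j := by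
  decide

/-- This shows that the list `p5812Facet` is complete. The slack `c - l` is nonnegative, so in an
affine dependency with positive coefficients on both sides one side vanishes identically exactly
when the other does; this restricts the zero sets enough for a finite check. -/
theorem exists_facet_of_isExposed_P5812 {X : Set (EuclideanSpace ℝ (Fin 5))}
    (hX : IsExposed ℝ P5812 X) (hXP : X ≠ P5812) :
    ∃ j, ∀ i, p5812Vertex i ∈ X → i ∈ p5812Facet j := by
  rcases X.eq_empty_or_nonempty with rfl | hne
  · exact ⟨0, fun i hi => absurd hi (Set.notMem_empty _)⟩
  obtain ⟨l, c, hl, hXl⟩ := hX.exists_eq_setOf hne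
  have hmem : ∀ i, p5812Vertex i ∈ X ↔ c - l (p5812Vertex i) = 0 := fun i => by
    rw [hXl, Set.mem_ofPred_eq, and_iff_right (p5812Vertex_mem i), sub_eq_zero, eq_comm]
  have hnn : ∀ i, 0 ≤ c - l (p5812Vertex i) := fun i => sub_nonneg.2 (hl _ (p5812Vertex_mem i))
  have e1 : p5812Vertex 0 + p5812Vertex 1 + p5812Vertex 5 =
      p5812Vertex 2 + p5812Vertex 3 + p5812Vertex 4 := by
    ext j
    fin_cases j <;> simp [p5812Vertex, p5812Coord]
  have e2 : p5812Vertex 0 + p5812Vertex 2 + p5812Vertex 7 =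
      p5812Vertex 1 + p5812Vertex 3 + p5812Vertex 6 := by
    ext j
    fin_cases j <;> simp [p5812Vertex, p5812Coord]
  replace e1 := congrArg l e1
  replace e2 := congrArg l e2
  simp only [map_add] at e1 e2
  have key : (∀ i, decide (p5812Vertex i ∈ X)) ∨
      -- The last two conditions of `p5812_zero_pattern` come from the sum and the difference of
      -- `e1` and `e2`: `2 v₀ + v₅ + v₇ = 2 v₃ + v₄ + v₆` and `2 v₁ + v₅ + v₆ = 2 v₂ + v₄ + v₇`.
      ∃ j, ∀ i, decide (p5812Vertex i ∈ X) → i ∈ p5812Facet j := by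
    apply p5812_zero_pattern fun i => decide (p5812Vertex i ∈ X)
    all_goals
      simp only [decide_eq_true_eq, hmem]
      have h0 := hnn 0
      have h1 := hnn 1
      have h2 := hnn 2
      have h3 := hnn 3
      have h4 := hnn 4
      have h5 := hnn 5
      have h6 := hnn 6
      have h7 := hnn 7
      constructor <;> rintro ⟨_, _, _⟩ <;> refine ⟨?_, ?_, ?_⟩ <;> linarith
  rcases key with h | ⟨j, hj⟩
  · refine absurd (hX.subset.antisymm ?_) hXP
    rw [p5812_subset_P5812_iff (IsExposed.refl _) hX]
    exact fun i _ => by simpa using h i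
  · exact ⟨j, fun i hi => hj i (by simpa using hi)⟩

theorem hasPyramidIncidence_P5812 : HasPyramidIncidence 0 P5812 := by
  intro V hV
  have hVe : V = Finset.univ.image p5812Vertex := by
    rw [← Finset.coe_inj, hV, vertexSet_P5812]
    simp
  choose F hF hFi using fun j => exists_face_P5812 _ _ (p5812Normal_le j)
  have hFv : ∀ j i, p5812Vertex i ∈ F j ↔ i ∈ p5812Facet j := fun j i => by
    rw [hFi, p5812Normal_eq_iff]
  have hFP : ∀ j, F j ≠ P5812 := fun j h => by
    have hall : p5812Facet j = Finset.univ := Finset.eq_univ_iff_forall.2 fun i => by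
      rw [← hFv, h]
      exact p5812Vertex_mem i
    exact (pyramidIncidence_p5812Facet.ssubset _ ⟨j, rfl⟩).ne hall
  have hFvert : ∀ j, vertexSet (F j) = (p5812Facet j).image p5812Vertex := fun j => by
    rw [IsPolytope.vertexSet_face (hF j), vertexSet_P5812]
    ext y
    simp only [Set.mem_inter_iff, Set.mem_range, Finset.coe_image, Set.mem_image, Finset.mem_coe]
    constructor
    · rintro ⟨hy, i, rfl⟩
      exact ⟨i, (hFv j i).1 hy, rfl⟩
    · rintro ⟨i, hi, rfl⟩
      exact ⟨(hFv j i).2 hi, i, rfl⟩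
  have hle : ∀ X, IsExposed ℝ P5812 X → X ≠ P5812 → ∃ j, X ⊆ F j := fun X hX hXP => by
    obtain ⟨j, hj⟩ := exists_facet_of_isExposed_P5812 hX hXP
    exact ⟨j, (p5812_subset_P5812_iff hX (hF j)).2 fun i hi => (hFv j i).2 (hj i hi)⟩
  rw [hVe]
  refine pyramidIncidence_p5812Facet.map p5812Vertex_injective.injOn fun T => ?_
  constructor
  · rintro ⟨X, hX, hT⟩
    obtain ⟨j, hj⟩ := hle X hX.1 hX.2.1
    refine ⟨_, ⟨j, rfl⟩, ?_⟩
    rw [← Finset.coe_inj, hT, ← hFvert, hX.2.2 _ (hF j) hj (hFP j)]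
  · rintro ⟨_, ⟨j, rfl⟩, rfl⟩
    refine ⟨F j, ⟨hF j, hFP j, fun Y hY hjY hYP => ?_⟩, (hFvert j).symm⟩
    obtain ⟨j', hj'⟩ := hle Y hY hYP
    have : j = j' := p5812Facet_antichain j j' fun i hi =>
      (hFv j' i).1 (hj' (hjY ((hFv j i).2 hi)))
    subst this
    exact hj'.antisymm hjY

theorem IsKFoldPyramidOver.isPolytope_and_hasPyramidIncidence {n : ℕ}
    {Q : Set (EuclideanSpace ℝ (Fin n))} (hQ : IsKFoldPyramidOver P5812 k Q) :
    IsPolytope Q ∧ HasPyramidIncidence k Q := by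
  induction k generalizing Q with
  | zero =>
    exact ⟨hQ.1, hasPyramidIncidence_P5812.of_combEquiv isPolytope_P5812 hQ.1
      (hQ.2.map fun φ => φ.symm)⟩
  | succ k ih =>
    obtain ⟨B, hB, hBk⟩ := hQ
    refine ⟨?_, HasPyramidIncidence.pyramid hB (ih hBk).2⟩
    obtain ⟨hBp, a, -, rfl⟩ := hB
    exact isPolytope_pyramid hBp

end P5812

/-! ### Incidences of 2-neighborly polytopes and the main theorem -/

section Main

open scoped Classical

variable {n : ℕ} {P : Set (EuclideanSpace ℝ (Fin n))}

theorem IsPolytope.exists_face_of_ne (hP : IsPolytope P) (hd : 1 ≤ affDim P)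
    {E : Set (EuclideanSpace ℝ (Fin n))} (hE : E ∈ facetSet P)
    {D : Set (EuclideanSpace ℝ (Fin n))} (hD : IsExposed ℝ P D) (hDE : D ⊆ E) (hne : D ≠ E) :
    ∃ E' ∈ facetSet P, E' ≠ E ∧ D ⊆ E' := by
  obtain ⟨x, hxE, hxD⟩ := Set.exists_of_ssubset (hDE.ssubset_of_ne hne)
  obtain ⟨H, hH, hDH, hxH⟩ := hP.exists_facet hd hD (hE.1.subset hxE) hxD
  exact ⟨H, hH, fun h => hxH (h ▸ hxE), hDH⟩

/-- The vertex-facet incidences of a 2-neighborly polytope. -/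
theorem IsPolytope.neighborlyIncidence (hP : IsPolytope P) (hd : 2 ≤ affDim P)
    (hneigh : IsTwoNeighborly P) {V : Finset (EuclideanSpace ℝ (Fin n))}
    (hV : (V : Set (EuclideanSpace ℝ (Fin n))) = vertexSet P)
    {𝓗 : Finset (Finset (EuclideanSpace ℝ (Fin n)))}
    (h𝓗 : ∀ T, T ∈ 𝓗 ↔ ∃ H ∈ facetSet P, (T : Set (EuclideanSpace ℝ (Fin n))) = vertexSet H) :
    NeighborlyIncidence V 𝓗
      (fun E H => ∃ H₀ ∈ facetSet P, (H : Set (EuclideanSpace ℝ (Fin n))) = vertexSet H₀ ∧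
        ∃ E₀ ∈ facetSet H₀, (E : Set (EuclideanSpace ℝ (Fin n))) = vertexSet E₀)
      (fun D => ∃ D₀, IsExposed ℝ P D₀ ∧
        (D : Set (EuclideanSpace ℝ (Fin n))) = vertexSet D₀) := by
  have hsub : ∀ {S T : Finset (EuclideanSpace ℝ (Fin n))} {X Y : Set (EuclideanSpace ℝ (Fin n))},
      IsExposed ℝ P X → IsExposed ℝ P Y → (S : Set (EuclideanSpace ℝ (Fin n))) = vertexSet X →
      (T : Set (EuclideanSpace ℝ (Fin n))) = vertexSet Y → (S ⊆ T ↔ X ⊆ Y) := by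
    intro S T X Y hX hY hS hT
    rw [hP.subset_iff hX hY, ← hS, ← hT, Finset.coe_subset]
  have heq : ∀ {S T : Finset (EuclideanSpace ℝ (Fin n))} {X Y : Set (EuclideanSpace ℝ (Fin n))},
      IsExposed ℝ P X → IsExposed ℝ P Y → (S : Set (EuclideanSpace ℝ (Fin n))) = vertexSet X →
      (T : Set (EuclideanSpace ℝ (Fin n))) = vertexSet Y → (S = T ↔ X = Y) := by
    intro S T X Y hX hY hS hT
    rw [Finset.Subset.antisymm_iff, Set.Subset.antisymm_iff, hsub hX hY hS hT, hsub hY hX hT hS]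
  have hfin : ∀ X, IsExposed ℝ P X → ∃ T : Finset (EuclideanSpace ℝ (Fin n)),
      (T : Set (EuclideanSpace ℝ (Fin n))) = vertexSet X := fun X hX =>
    ⟨(hP.finite_vertexSet.subset Set.inter_subset_right).toFinset,
      (Set.Finite.coe_toFinset _).trans (IsPolytope.vertexSet_face hX).symm⟩
  have hvinter : ∀ X Y, IsExposed ℝ P X → IsExposed ℝ P Y →
      vertexSet (X ∩ Y) = vertexSet X ∩ vertexSet Y := fun X Y hX hY => by
    rw [IsPolytope.vertexSet_face hX, IsPolytope.vertexSet_face hY,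
      IsPolytope.vertexSet_face (hX.inter hY), Set.inter_inter_distrib_right]
  have hdim : ∀ H ∈ facetSet P, 1 ≤ affDim H := fun H hH => by
    have := hH.2.2
    omega
  constructor
  · intro H hH
    obtain ⟨H₀, hH₀, hHH⟩ := (h𝓗 H).1 hH
    rw [hsub hH₀.1 (IsExposed.refl P) hHH hV]
    exact hH₀.1.subset
  · intro H hH
    obtain ⟨H₀, hH₀, hHH⟩ := (h𝓗 H).1 hH
    exact ⟨H₀, hH₀.1, hHH⟩
  · rintro A B ⟨A₀, hA₀, hA⟩ ⟨B₀, hB₀, hB⟩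
    exact ⟨A₀ ∩ B₀, hA₀.inter hB₀, by rw [Finset.coe_inter, hA, hB, hvinter _ _ hA₀ hB₀]⟩
  · rintro E H - ⟨H₀, hH₀, hH, E₀, hE₀, hE⟩
    have hE₀P := hP.trans hH₀.1 hE₀.1
    obtain ⟨x, hxH, hxE⟩ :=
      Set.exists_of_ssubset (hE₀.1.subset.ssubset_of_ne (facet_ne hE₀))
    -- As `H₁` misses a point of `H₀`, the intersection `H₀ ∩ H₁` is a proper face of `H₀`
    -- containing the facet `E₀`, hence equal to it.
    obtain ⟨H₁, hH₁, hEH₁, hxH₁⟩ := hP.exists_facet (by omega) hE₀P (hH₀.1.subset hxH) hxE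
    obtain ⟨T, hT⟩ := hfin H₁ hH₁.1
    refine ⟨T, (h𝓗 T).2 ⟨H₁, hH₁, hT⟩, fun h => ?_, ?_⟩
    · rw [heq hH₁.1 hH₀.1 hT hH] at h
      exact hxH₁ (h ▸ hxH)
    · have hinter := hH₀.1.inter hH₁.1
      rw [heq hE₀P hinter hE (by rw [Finset.coe_inter, hH, hT, hvinter _ _ hH₀.1 hH₁.1])]
      exact facet_eq_of_subset hE₀ (hinter.mono hH₀.1.subset Set.inter_subset_left)
        (fun h => hxH₁ ((h.symm.subset hxH).2)) (Set.subset_inter hE₀.1.subset hEH₁)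
  · rintro E D H - ⟨H₀, hH₀, hH, E₀, hE₀, hE⟩ ⟨D₀, hD₀, hD⟩ hDE hne
    have hE₀P := hP.trans hH₀.1 hE₀.1
    rw [hsub hD₀ hE₀P hD hE] at hDE
    rw [ne_eq, heq hD₀ hE₀P hD hE] at hne
    obtain ⟨E₁, hE₁, hne₁, hDE₁⟩ := (hP.face hH₀.1 hH₀.2.1).exists_face_of_ne (hdim H₀ hH₀) hE₀
      (hD₀.mono hH₀.1.subset (hDE.trans hE₀.1.subset)) hDE hne
    have hE₁P := hP.trans hH₀.1 hE₁.1
    obtain ⟨T, hT⟩ := hfin E₁ hE₁P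
    exact ⟨T, ⟨H₀, hH₀, hH, E₁, hE₁, hT⟩, fun h => hne₁ ((heq hE₁P hE₀P hT hE).1 h),
      (hsub hD₀ hE₁P hD hT).2 hDE₁⟩
  · rintro E F - H hH ⟨F₀, hF₀, -, E₀, hE₀, hE⟩ hEH -
    obtain ⟨H₀, hH₀, hHH⟩ := (h𝓗 H).1 hH
    have hE₀P := hP.trans hF₀.1 hE₀.1
    rw [hsub hE₀P hH₀.1 hE hHH] at hEH
    refine ⟨H₀, hH₀, hHH, E₀, ⟨hE₀P.mono hH₀.1.subset hEH, hE₀.2.1, ?_⟩, hE⟩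
    have h1 := hE₀.2.2
    have h2 := hF₀.2.2
    have h3 := hH₀.2.2
    omega
  · rintro E E' H - ⟨H₀, hH₀, hH, E₀, hE₀, hE⟩ ⟨H₁, hH₁, hH', E₁, hE₁, hE'⟩ hEE'
    obtain rfl := (heq hH₀.1 hH₁.1 hH hH').1 rfl
    have hE₀P := hP.trans hH₀.1 hE₀.1
    have hE₁P := hP.trans hH₀.1 hE₁.1
    rw [hsub hE₀P hE₁P hE hE'] at hEE'
    rw [heq hE₀P hE₁P hE hE']
    exact facet_eq_of_subset hE₀ hE₁.1 (facet_ne hE₁) hEE'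
  · intro H hH H' hH' hHH'
    obtain ⟨H₀, hH₀, hHH⟩ := (h𝓗 H).1 hH
    obtain ⟨H₁, hH₁, hHH₁⟩ := (h𝓗 H').1 hH'
    rw [hsub hH₀.1 hH₁.1 hHH hHH₁] at hHH'
    rw [heq hH₀.1 hH₁.1 hHH hHH₁]
    exact facet_eq_of_subset hH₀ hH₁.1 (facet_ne hH₁) hHH'
  · intro x hx y hy z hz hxy hzx hzy
    rw [← Finset.mem_coe, hV] at hx hy hz
    -- The edge from `x` to `y` is a face by 2-neighborliness, and an extreme point `z` is not on
    -- it, so some facet contains the edge and misses `z`.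
    have hznot : z ∉ segment ℝ x y := fun h => by
      rcases (mem_extremePoints_iff_forall_segment.1 hz).2 x hx.1 y hy.1 h with h | h
      · exact hzx h.symm
      · exact hzy h.symm
    obtain ⟨H₀, hH₀, hxyH, hzH⟩ := hP.exists_facet (by omega) (hneigh x hx y hy hxy) hz.1 hznot
    obtain ⟨T, hT⟩ := hfin H₀ hH₀.1
    have hmem : ∀ w ∈ vertexSet P, w ∈ T ↔ w ∈ H₀ := fun w hw => by
      rw [← Finset.mem_coe, hT, IsPolytope.vertexSet_face hH₀.1]
      exact and_iff_left hw
    exact ⟨T, (h𝓗 T).2 ⟨H₀, hH₀, hT⟩, (hmem x hx).2 (hxyH (left_mem_segment ℝ x y)),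
      (hmem y hy).2 (hxyH (right_mem_segment ℝ x y)), fun h => hzH ((hmem z hz).1 h)⟩

/-- A point of the affine span would enlarge `X` within `P` without raising the dimension. -/
theorem notMem_affineSpan_of_isExposed {X : Set (EuclideanSpace ℝ (Fin n))}
    (hX : IsExposed ℝ P X) (hne : X.Nonempty) {a : EuclideanSpace ℝ (Fin n)} (ha : a ∈ P)
    (haX : a ∉ X) : a ∉ affineSpan ℝ X := by
  intro hspan
  have h1 : vectorSpan ℝ (insert a X) = vectorSpan ℝ X := by
    rw [← direction_affineSpan, affineSpan_insert_eq_affineSpan ℝ hspan, direction_affineSpan]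
  have h2 := hX.eq_of_affDim_le hne (Set.subset_insert a X) (Set.insert_subset ha hX.subset)
    (by rw [affDim, affDim, h1])
  exact haX (h2.symm.subset (Set.mem_insert a X))

end Main

theorem mainTheorem8 (k : ℕ) (hk : 1 ≤ k) (m n : ℕ)
    (Q : Set (EuclideanSpace ℝ (Fin m))) (hQ : IsKFoldPyramidOver P5812 k Q)
    (P : Set (EuclideanSpace ℝ (Fin n))) (hP : IsDPolytope (k + 6) P)
    (hneigh : IsTwoNeighborly P)
    (hfacets : (facetSet P).encard ≤ ((k + 15 : ℕ) : ℕ∞))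
    (hlarge : ∃ F ∈ facetSet P, ((k + 8 : ℕ) : ℕ∞) ≤ (vertexSet F).encard)
    (hequiv : ∀ F ∈ facetSet P, ((k + 8 : ℕ) : ℕ∞) ≤ (vertexSet F).encard → CombEquiv F Q) :
    IsPyramidOver P Q := by
  classical
  obtain ⟨hPp, hPd⟩ := hP
  obtain ⟨hQp, hQi⟩ := hQ.isPolytope_and_hasPyramidIncidence
  set V := hPp.finite_vertexSet.toFinset with hVdef
  have hV : (V : Set (EuclideanSpace ℝ (Fin n))) = vertexSet P := by simp [hVdef]
  have hfin : (facetSet P).Finite := Set.finite_of_encard_le_coe hfacets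
  set vs : Set (EuclideanSpace ℝ (Fin n)) → Finset (EuclideanSpace ℝ (Fin n)) :=
    fun X => V.filter (· ∈ X) with hvs
  have hvsc : ∀ X, IsExposed ℝ P X →
      (vs X : Set (EuclideanSpace ℝ (Fin n))) = vertexSet X := fun X hX => by
    rw [IsPolytope.vertexSet_face hX, ← hV]
    ext y
    simp [hvs, and_comm]
  set 𝓗 := hfin.toFinset.image vs with h𝓗def
  have h𝓗 : ∀ T, T ∈ 𝓗 ↔ ∃ H ∈ facetSet P,
      (T : Set (EuclideanSpace ℝ (Fin n))) = vertexSet H := fun T => by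
    rw [h𝓗def, Finset.mem_image]
    constructor
    · rintro ⟨H, hH, rfl⟩
      have hH' := hfin.mem_toFinset.1 hH
      exact ⟨H, hH', hvsc H hH'.1⟩
    · rintro ⟨H, hH, hT⟩
      refine ⟨H, hfin.mem_toFinset.2 hH, ?_⟩
      rw [← Finset.coe_inj, hvsc H hH.1, hT]
  have hcard : 𝓗.card ≤ k + 15 := by
    refine Finset.card_image_le.trans ?_
    rw [hfin.encard_eq_coe_toFinset_card] at hfacets
    exact_mod_cast hfacets
  have hencard : ∀ (T : Finset (EuclideanSpace ℝ (Fin n))) (X : Set (EuclideanSpace ℝ (Fin n))),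
      (T : Set (EuclideanSpace ℝ (Fin n))) = vertexSet X →
      (((k + 8 : ℕ) : ℕ∞) ≤ (vertexSet X).encard ↔ k + 8 ≤ T.card) := fun T X hT => by
    rw [← hT, Set.encard_coe_eq_coe_finsetCard]
    norm_cast
  have hN := hPp.neighborlyIncidence (by omega) hneigh hV h𝓗
  have hlarge' : ∃ F ∈ 𝓗, k + 8 ≤ F.card := by
    obtain ⟨F, hF, hFc⟩ := hlarge
    exact ⟨vs F, (h𝓗 _).2 ⟨F, hF, hvsc F hF.1⟩, (hencard _ F (hvsc F hF.1)).1 hFc⟩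
  obtain ⟨T, hT, a, haV, haT, hVT⟩ := hN.exists_pyramid hk hcard hlarge' (by
    intro T hT hTc
    obtain ⟨F, hF, hTF⟩ := (h𝓗 T).1 hT
    have hFp := hPp.face hF.1 hF.2.1
    have hFd : 1 ≤ affDim F := by
      have := hF.2.2
      omega
    obtain ⟨φ⟩ := hequiv F hF ((hencard T F hTF).2 hTc)
    convert hQi.of_combEquiv hQp hFp ⟨φ.symm⟩ T hTF using 2 with E
    simp only [hFp.isMaximalFace_iff hFd]
    constructor
    · rintro ⟨F', hF', hTF', E₀, hE₀, hE⟩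
      rw [hPp.eq_of_vertexSet_eq hF'.1 hF.1 (hTF'.symm.trans hTF)] at hE₀
      exact ⟨E₀, hE₀, hE⟩
    · rintro ⟨E₀, hE₀, hE⟩
      exact ⟨F, hF, hTF, E₀, hE₀, hE⟩)
  obtain ⟨B, hB, hTB⟩ := (h𝓗 T).1 hT
  have hBp := hPp.face hB.1 hB.2.1
  have haP : a ∈ vertexSet P := hV ▸ Finset.mem_coe.2 haV
  have haB : a ∉ B := fun haB => haT (by
    rw [← Finset.mem_coe, hTB, IsPolytope.vertexSet_face hB.1]
    exact ⟨haB, haP⟩)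
  -- The base found need not be `F`, but it misses only one vertex of `P`, while any other facet
  -- misses at least one; so it is also large and `hequiv` applies.
  have hTc : k + 8 ≤ T.card := by
    obtain ⟨F, hF, hFc⟩ := hlarge'
    by_cases hFT : F = T
    · exact hFT ▸ hFc
    · have h1 : F ⊂ V := (hN.subset F hF).ssubset_of_ne fun h =>
        hFT (hN.antichain T hT F hF (h ▸ hN.subset T hT)).symm
      have h2 := Finset.card_lt_card h1
      have h3 := Finset.card_le_card hVT
      rw [Finset.card_erase_of_mem haV] at h3
      omega
  refine ⟨B, ⟨hBp, a, notMem_affineSpan_of_isExposed hB.1 hB.2.1 haP.1 haB, ?_⟩,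
    hequiv B hB ((hencard T B hTB).2 hTc)⟩
  refine Set.Subset.antisymm ?_ (convexHull_min (Set.insert_subset haP.1 hB.1.subset) hPp.convex)
  conv_lhs => rw [hPp.eq_convexHull]
  refine convexHull_mono fun y hy => ?_
  rcases eq_or_ne y a with rfl | hya
  · exact Set.mem_insert _ _
  · refine Set.mem_insert_of_mem _ ?_
    have : y ∈ T := hVT (Finset.mem_erase.2 ⟨hya, by rwa [← Finset.mem_coe, hV]⟩)
    rw [← Finset.mem_coe, hTB] at this
    exact this.1
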